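/- Let $Q_n$ denote the $n$-dimensional Boolean lattice, i.e. the set of all subsets of $[n]=\{1,\dots,n\}$ ordered by inclusion. A family $\mathcal F\subseteq Q_n$ is called $Q_2$-free if there is no injective map $f$ from $Q_2$ into $\mathcal F$ such that $x\subseteq y$ implies $f(x)\subseteq f(y)$; equivalently, $\mathcal F$ contains no four distinct sets $A,B,C,D$ with $A\subset B\subset D$ and $A\subset C\subset D$ (no condition is imposed between $B$ and $C$). Let $\mathrm{ex}(n,Q_2)$ be the largest size of a $Q_2$-free family of subsets of $[n]$, and let $N=\binom{n}{\lfloor n/2\rfloor}$. Then, as $n\to\infty$, $$2N-o(N)\;\le\;\mathrm{ex}(n,Q_2)\;\le\;2.283261\,N+o(N).$$ Moreover, the lower bound is attained by the two middle layers: the family of all subsets of $[n]$ of size $\lfloor n/2\rfloor$ or $\lfloor n/2\rfloor+1$ is $Q_2$-free and has at least $2N-o(N)$ members. -/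

import Mathlib

open Filter Asymptotics

namespace BooleanLattice

/-- The `n`-dimensional Boolean lattice: all subsets of an `n`-element set, ordered by inclusion. -/
abbrev Q (n : ℕ) : Type := Finset (Fin n)

/-- `P` is a (not necessarily induced) subposet of `R`: there is an injective order-preserving
map from `P` to `R`. -/
def IsSubposet (P R : Type) [PartialOrder P] [PartialOrder R] : Prop :=
  ∃ f : P → R, Function.Injective f ∧ ∀ x y : P, x ≤ y → f x ≤ f y

/-- A family `F` of subsets of an `n`-element set, ordered by inclusion, is `P`-free if it does
not contain `P` as a subposet. -/
def IsFree (P : Type) [PartialOrder P] {n : ℕ} (F : Finset (Q n)) : Prop :=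
  ¬ IsSubposet P {A : Q n // A ∈ F}

open Classical in
/-- `ex n P` is the largest size of a `P`-free family of subsets of an `n`-element set. -/
noncomputable def ex (n : ℕ) (P : Type) [PartialOrder P] : ℕ :=
  ((Finset.univ : Finset (Finset (Q n))).filter (fun F => IsFree P F)).sup Finset.card

/-- The size of a middle layer of the `n`-dimensional Boolean lattice. -/
def N (n : ℕ) : ℕ := n.choose (n / 2)

/-- The `i`th layer: all `i`-element subsets of an `n`-element set. -/
def layer (n i : ℕ) : Finset (Q n) := Finset.powersetCard i Finset.univ

end BooleanLattice

/-!
# Families without a diamond in the Boolean lattice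

The lower bound is the two middle layers. For the upper bound, the Lubell function of a family `F`
on a cube `2 ^ U` is the expected number of members of `F` on a random maximal chain of that cube.
On the whole cube it is at least `#F / N n`, so it suffices to bound it by `2.283261`, after
discarding the polynomially many members of `F` with fewer than `20000` elements.

Deleting the points of `U` one at a time from the top does not change the average of the Lubell
function until a member of `F` is reached (`lubell_eq_avg`). Hence `U` may be assumed to lie in `F`
(`lubell_le_of_isDiamondFree`). Taking complements in `U` turns the members of `F` strictly below
`U` into a family `G` in which every member properly contains at most one other member, and
`1 + lubell G U` is the quantity to be bounded.

The same deletion argument, applied to `G`, stops either at a triple or at a set `V ∈ G` with at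
least three elements, and `G` has at most two members inside such a `V`. This bounds
`lubell G U - 1` by the average over ordered triples of an explicit weight depending only on which
singletons and pairs belong to `G`, plus a quarter of the proportion of quadruples that contain
almost no member of `G` of size at most two (`lubell_le_tripleAvg_add_quadAvg`).

It remains to solve an extremal problem on points coloured red (singletons in `G`) or white, with a
graph on the white points (pairs in `G`) and a bipartite graph of missing red-white pairs. Write `x`
for the density of white points. The triple weight yields, for each white point of edge density `d`,
the term `d (x - d)`, minus two for each induced cherry. The quadruples yield
`(x - d) (x / 2 - d) ^ 2` for each white point, at the price of at most half a unit for each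
induced cherry, so that the cherries can be dropped. The contribution of the red points is bounded
by comparing the number of red points with two missing pairs to an independent pair of white
points with both the number of missing pairs and the number of white non-edges. In total there is
a quartic polynomial in `x` and `d`, which never exceeds `0.281` (`quartic_le`); the passage from
sums over all tuples to averages over distinct ones costs `O(1 / #U)`.
-/

namespace BooleanLattice

open Finset

/-! ### Averaging over the subsets obtained by deleting a point -/

theorem sum_sum_subset_erase {ι α : Type*} [DecidableEq α] (I : Finset ι) (s : ι → Finset α)
    (f : ι → ℝ) (U : Finset α) :
    ∑ v ∈ U, ∑ i ∈ I with s i ⊆ U.erase v, f i =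
      ∑ i ∈ I with s i ⊆ U, ((#U : ℝ) - #(s i)) * f i := by
  simp_rw [sum_filter]
  rw [sum_comm]
  refine sum_congr rfl fun i _ => ?_
  by_cases h : s i ⊆ U
  · have hc : (#(U \ s i) : ℝ) = #U - #(s i) := by
      rw [card_sdiff_of_subset h, Nat.cast_sub (card_le_card h)]
    simp only [subset_erase, h, true_and, if_true]
    rw [← sum_filter, sum_const, nsmul_eq_mul, ← hc, sdiff_eq_filter]
  · simp [subset_erase, h]

/-- The Lubell function of the members of `G` inside the cube `2 ^ U`: the expected number of
members of `G` on a uniformly random maximal chain from `∅` to `U`. -/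
noncomputable def lubell {α : Type*} [DecidableEq α] (G : Finset (Finset α)) (U : Finset α) : ℝ :=
  ∑ B ∈ G with B ⊆ U, ((#U).choose #B : ℝ)⁻¹

theorem lubell_eq_avg {α : Type*} [DecidableEq α] {G : Finset (Finset α)} {U : Finset α}
    (hU : U ∉ G) : (#U : ℝ) * lubell G U = ∑ v ∈ U, lubell G (U.erase v) := by
  have h1 : ∀ v ∈ U, lubell G (U.erase v) =
      ∑ B ∈ G with B ⊆ U.erase v, ((#U - 1).choose #B : ℝ)⁻¹ := by
    intro v hv
    simp [lubell, card_erase_of_mem hv]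
  rw [sum_congr rfl h1, sum_sum_subset_erase G (fun B => B), lubell, mul_sum]
  refine sum_congr rfl fun B hB => ?_
  rw [mem_filter] at hB
  have hss : B ⊂ U := hB.2.ssubset_of_ne (fun h => hU (h ▸ hB.1))
  have hlt := card_lt_card hss
  obtain ⟨m, hm⟩ : ∃ m, #U = m + 1 := ⟨#U - 1, by omega⟩
  rw [hm] at hlt ⊢
  have key := Nat.choose_mul_succ_eq m #B
  have key' : (m.choose #B : ℝ) * (m + 1) = (m + 1).choose #B * ((m + 1 : ℝ) - #B) := by
    have := congrArg (Nat.cast : ℕ → ℝ) key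
    push_cast [Nat.cast_sub hlt.le] at this
    exact this
  have p1 : (0 : ℝ) < m.choose #B := by exact_mod_cast Nat.choose_pos (by omega)
  have p2 : (0 : ℝ) < (m + 1).choose #B := by exact_mod_cast Nat.choose_pos (by omega)
  simp only [Nat.add_sub_cancel]
  push_cast
  field_simp
  linarith

/-- Average over the members of `I` whose support `s i`, a `k`-element set, lies in `U`, when
`k!` members of `I` share each support. -/
noncomputable def subAvg {ι α : Type*} [DecidableEq α] (k : ℕ) (I : Finset ι) (s : ι → Finset α)
    (f : ι → ℝ) (U : Finset α) : ℝ :=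
  (∑ i ∈ I with s i ⊆ U, f i) / (#U).descFactorial k

theorem subAvg_eq_avg {ι α : Type*} [DecidableEq α] {k : ℕ} {I : Finset ι} {s : ι → Finset α}
    (hs : ∀ i ∈ I, #(s i) = k) (f : ι → ℝ) {U : Finset α} (hU : k < #U) :
    (#U : ℝ) * subAvg k I s f U = ∑ v ∈ U, subAvg k I s f (U.erase v) := by
  obtain ⟨m, hm⟩ : ∃ m, #U = m + 1 := ⟨#U - 1, by omega⟩
  have h1 : ∀ v ∈ U, subAvg k I s f (U.erase v) =
      (∑ i ∈ I with s i ⊆ U.erase v, f i) / m.descFactorial k := by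
    intro v hv
    simp [subAvg, card_erase_of_mem hv, hm]
  rw [sum_congr rfl h1, ← sum_div, sum_sum_subset_erase, subAvg]
  have h2 : ∀ i ∈ I.filter (fun i => s i ⊆ U), ((#U : ℝ) - #(s i)) * f i = (m + 1 - k) * f i := by
    intro i hi
    rw [hs i (mem_filter.1 hi).1, hm]; push_cast; rfl
  rw [sum_congr rfl h2, ← mul_sum, hm]
  have key := Nat.succ_descFactorial m k
  have key' : ((m : ℝ) + 1 - k) * (m + 1).descFactorial k = (m + 1) * m.descFactorial k := by
    have := congrArg (Nat.cast : ℕ → ℝ) key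
    push_cast [Nat.cast_sub (show k ≤ m + 1 by omega)] at this
    exact this
  have p1 : (0 : ℝ) < m.descFactorial k := by
    exact_mod_cast Nat.descFactorial_pos.2 (by omega)
  have p2 : (0 : ℝ) < (m + 1).descFactorial k := by
    exact_mod_cast Nat.descFactorial_pos.2 (by omega)
  push_cast
  field_simp
  linear_combination (-(∑ i ∈ I with s i ⊆ U, f i)) * key'

/-! ### Wedge-free families and their local weights -/

/-- `G` consists of nonempty sets, each of which properly contains at most one other member of
`G`. These are the families for which `G ∪ {∅}` contains no diamond with bottom `∅`. -/
def IsWedgeFree {α : Type*} (G : Finset (Finset α)) : Prop :=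
  ∅ ∉ G ∧ ∀ D ∈ G, ∀ B ∈ G, ∀ C ∈ G, B ⊂ D → C ⊂ D → B = C

section Weights

variable {α : Type*} [DecidableEq α]

/-- Indicator of the red points: those whose singleton belongs to `G`. -/
def red (G : Finset (Finset α)) (a : α) : ℝ := if {a} ∈ G then 1 else 0

/-- Indicator of the white (not red) points. -/
def white (G : Finset (Finset α)) (a : α) : ℝ := 1 - red G a

/-- Indicator of the edges: pairs of white points that belong to `G`. -/
def edge (G : Finset (Finset α)) (a b : α) : ℝ :=
  white G a * white G b * if {a, b} ∈ G then 1 else 0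

/-- Indicator of the missing pairs: `a` is red, `b` is white and the pair is not in `G`. -/
def miss (G : Finset (Finset α)) (a b : α) : ℝ :=
  red G a * white G b * if {a, b} ∈ G then 0 else 1

/-- The weight of an ordered triple. The three summands treat triples with two, one and no red
points, and its sum over the six orderings of a triple `τ` is at least `6 (L - 1)`, where `L` is
the Lubell function of `G` on `2 ^ τ`. -/
def tripleWeight (G : Finset (Finset α)) (a b c : α) : ℝ :=
  red G a * red G b * white G c * (1 - 2 * miss G a c) +
  red G a * white G b * white G c *
    (edge G b c - 2 * miss G a b + 3 * (miss G a b * miss G a c * (1 - edge G b c))) +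
  (edge G a b * white G c * (1 - edge G a c) -
    2 * (edge G a b * edge G a c * (1 - edge G b c)))

/-- One quarter of the indicator that `a, b, c, d` are white with no edge among them, except
perhaps between `c` and `d`. -/
noncomputable def quadWeight (G : Finset (Finset α)) (a b c d : α) : ℝ :=
  1 / 4 * (white G a * white G b * (1 - edge G a b)) *
    (white G c * (1 - edge G a c) * (1 - edge G b c)) *
    (white G d * (1 - edge G a d) * (1 - edge G b d))

theorem red_eq (G : Finset (Finset α)) (a : α) : red G a = 0 ∨ red G a = 1 := by
  unfold red; split_ifs <;> simp

theorem white_eq (G : Finset (Finset α)) (a : α) : white G a = 0 ∨ white G a = 1 := by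
  unfold white red; split_ifs <;> simp

theorem edge_eq (G : Finset (Finset α)) (a b : α) : edge G a b = 0 ∨ edge G a b = 1 := by
  unfold edge white red; split_ifs <;> simp

theorem miss_eq (G : Finset (Finset α)) (a b : α) : miss G a b = 0 ∨ miss G a b = 1 := by
  unfold miss white red; split_ifs <;> simp

theorem edge_comm (G : Finset (Finset α)) (a b : α) : edge G a b = edge G b a := by
  unfold edge; rw [pair_comm, mul_comm (white G a)]

theorem white_mul_edge (G : Finset (Finset α)) (a b : α) :
    white G a * edge G a b = edge G a b := by
  unfold edge; rcases white_eq G a with h | h <;> simp [h]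

theorem white_mul_edge' (G : Finset (Finset α)) (a b : α) :
    white G b * edge G a b = edge G a b := by
  rw [edge_comm, white_mul_edge]

theorem red_mul_miss (G : Finset (Finset α)) (a b : α) : red G a * miss G a b = miss G a b := by
  unfold miss; rcases red_eq G a with h | h <;> simp [h]

theorem white_mul_miss (G : Finset (Finset α)) (a b : α) :
    white G b * miss G a b = miss G a b := by
  unfold miss; rcases white_eq G b with h | h <;> simp [h]

theorem quadWeight_nonneg (G : Finset (Finset α)) (a b c d : α) : 0 ≤ quadWeight G a b c d := by
  have hw : ∀ x, 0 ≤ white G x := fun x => by rcases white_eq G x with h | h <;> simp [h]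
  have he : ∀ x y, 0 ≤ 1 - edge G x y := fun x y => by
    rcases edge_eq G x y with h | h <;> simp [h]
  unfold quadWeight
  have := hw a; have := hw b; have := hw c; have := hw d
  have := he a b; have := he a c; have := he b c; have := he a d; have := he b d
  positivity

/-- The ordered triples of distinct points. -/
def triples (α : Type*) [DecidableEq α] [Fintype α] : Finset (α × α × α) :=
  {p | p.1 ≠ p.2.1 ∧ p.1 ≠ p.2.2 ∧ p.2.1 ≠ p.2.2}

/-- The ordered quadruples of distinct points. -/
def quads (α : Type*) [DecidableEq α] [Fintype α] : Finset (α × α × α × α) :=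
  {p | (p.1 ≠ p.2.1 ∧ p.1 ≠ p.2.2.1 ∧ p.1 ≠ p.2.2.2) ∧
    (p.2.1 ≠ p.2.2.1 ∧ p.2.1 ≠ p.2.2.2) ∧ p.2.2.1 ≠ p.2.2.2}

/-- Average of `tripleWeight` over the ordered triples of distinct points of `U`. -/
noncomputable def tripleAvg [Fintype α] (G : Finset (Finset α)) (U : Finset α) : ℝ :=
  subAvg 3 (triples α) (fun p => {p.1, p.2.1, p.2.2})
    (fun p => tripleWeight G p.1 p.2.1 p.2.2) U

/-- Average of `quadWeight` over the ordered quadruples of distinct points of `U`. -/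
noncomputable def quadAvg [Fintype α] (G : Finset (Finset α)) (U : Finset α) : ℝ :=
  subAvg 4 (quads α) (fun p => {p.1, p.2.1, p.2.2.1, p.2.2.2})
    (fun p => quadWeight G p.1 p.2.1 p.2.2.1 p.2.2.2) U

theorem sum_triples [Fintype α] (f : α → α → α → ℝ) (U : Finset α) :
    ∑ p ∈ triples α with {p.1, p.2.1, p.2.2} ⊆ U, f p.1 p.2.1 p.2.2 =
      ∑ a ∈ U, ∑ b ∈ U, ∑ c ∈ U, if a ≠ b ∧ a ≠ c ∧ b ≠ c then f a b c else 0 := by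
  have h : (triples α).filter (fun p => ({p.1, p.2.1, p.2.2} : Finset α) ⊆ U) =
      (U ×ˢ U ×ˢ U).filter (fun p => p.1 ≠ p.2.1 ∧ p.1 ≠ p.2.2 ∧ p.2.1 ≠ p.2.2) := by
    ext p
    simp only [triples, mem_filter, mem_univ, true_and, insert_subset_iff, singleton_subset_iff,
      mem_product]
    tauto
  rw [h, sum_filter, sum_product]
  simp_rw [sum_product]

theorem sum_quads_le [Fintype α] {f : α → α → α → α → ℝ} (hf : ∀ a b c d, 0 ≤ f a b c d)
    (U : Finset α) :
    ∑ p ∈ quads α with {p.1, p.2.1, p.2.2.1, p.2.2.2} ⊆ U, f p.1 p.2.1 p.2.2.1 p.2.2.2 ≤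
      ∑ a ∈ U, ∑ b ∈ U, ∑ c ∈ U, ∑ d ∈ U, f a b c d := by
  have h : ∑ a ∈ U, ∑ b ∈ U, ∑ c ∈ U, ∑ d ∈ U, f a b c d =
      ∑ p ∈ U ×ˢ U ×ˢ U ×ˢ U, f p.1 p.2.1 p.2.2.1 p.2.2.2 := by
    rw [sum_product]; simp_rw [sum_product]
  rw [h]
  refine sum_le_sum_of_subset_of_nonneg (fun p => ?_) fun _ _ _ => hf _ _ _ _
  simp only [mem_filter, insert_subset_iff, singleton_subset_iff, mem_product]
  tauto

theorem sum_ne_one {U : Finset α} {a : α} (ha : a ∈ U) :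
    ∑ b ∈ U, (if a ≠ b then 1 else 0 : ℕ) = #U - 1 := by
  rw [← card_filter, ← card_erase_of_mem ha, filter_ne]

theorem sum_ne_two {U : Finset α} {a b : α} (ha : a ∈ U) (hb : b ∈ U) (hab : a ≠ b) :
    ∑ c ∈ U, (if a ≠ c ∧ b ≠ c then 1 else 0 : ℕ) = #U - 2 := by
  have h : b ∈ U.erase a := mem_erase.2 ⟨hab.symm, hb⟩
  rw [← card_filter, filter_and, filter_ne, filter_ne, erase_inter, inter_erase, inter_self,
    erase_right_comm, card_erase_of_mem h, card_erase_of_mem ha]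
  omega

theorem sum_ne_three {U : Finset α} {a b c : α} (ha : a ∈ U) (hb : b ∈ U) (hc : c ∈ U)
    (hab : a ≠ b) (hac : a ≠ c) (hbc : b ≠ c) :
    ∑ d ∈ U, (if a ≠ d ∧ b ≠ d ∧ c ≠ d then 1 else 0 : ℕ) = #U - 3 := by
  rw [← card_filter]
  have : U.filter (fun d => a ≠ d ∧ b ≠ d ∧ c ≠ d) = U \ {a, b, c} := by
    ext d
    simp only [mem_filter]
    grind
  rw [this, card_sdiff_of_subset (by grind), card_eq_three.2 ⟨a, b, c, hab, hac, hbc, rfl⟩]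

theorem card_quads [Fintype α] (U : Finset α) :
    #{p ∈ quads α | {p.1, p.2.1, p.2.2.1, p.2.2.2} ⊆ U} = (#U).descFactorial 4 := by
  have h : (quads α).filter (fun p => ({p.1, p.2.1, p.2.2.1, p.2.2.2} : Finset α) ⊆ U) =
      (U ×ˢ U ×ˢ U ×ˢ U).filter (fun p => (p.1 ≠ p.2.1 ∧ p.1 ≠ p.2.2.1 ∧ p.1 ≠ p.2.2.2) ∧
    (p.2.1 ≠ p.2.2.1 ∧ p.2.1 ≠ p.2.2.2) ∧ p.2.2.1 ≠ p.2.2.2) := by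
    ext p
    simp only [quads, mem_filter, mem_univ, true_and, insert_subset_iff, singleton_subset_iff,
      mem_product]
    tauto
  rw [h, card_filter, sum_product]
  simp_rw [sum_product]
  have h1 : ∀ a ∈ U, ∀ b ∈ U, ∀ c ∈ U, (∑ d ∈ U, (if (a ≠ b ∧ a ≠ c ∧ a ≠ d) ∧
      (b ≠ c ∧ b ≠ d) ∧ c ≠ d then 1 else 0 : ℕ)) =
      (if a ≠ b then if a ≠ c ∧ b ≠ c then 1 else 0 else 0) * (#U - 3) := by
    intro a ha b hb c hc
    split_ifs with hab hac
    · rw [← sum_ne_three ha hb hc hab hac.1 hac.2, one_mul]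
      exact sum_congr rfl fun d _ => if_congr (by tauto) rfl rfl
    · rw [zero_mul]; exact sum_eq_zero fun d _ => if_neg (by tauto)
    · rw [zero_mul]; exact sum_eq_zero fun d _ => if_neg (by tauto)
  have h2 : ∀ a ∈ U, ∀ b ∈ U, (∑ c ∈ U, ∑ d ∈ U, (if (a ≠ b ∧ a ≠ c ∧ a ≠ d) ∧
      (b ≠ c ∧ b ≠ d) ∧ c ≠ d then 1 else 0 : ℕ)) =
      (if a ≠ b then 1 else 0) * ((#U - 2) * (#U - 3)) := by
    intro a ha b hb
    rw [sum_congr rfl (h1 a ha b hb), ← sum_mul]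
    split_ifs with hab
    · rw [sum_ne_two ha hb hab, one_mul]
    · simp
  have h3 : ∀ a ∈ U, (∑ b ∈ U, ∑ c ∈ U, ∑ d ∈ U, (if (a ≠ b ∧ a ≠ c ∧ a ≠ d) ∧
      (b ≠ c ∧ b ≠ d) ∧ c ≠ d then 1 else 0 : ℕ)) = (#U - 1) * ((#U - 2) * (#U - 3)) := by
    intro a ha
    rw [sum_congr rfl (h2 a ha), ← sum_mul, sum_ne_one ha]
  rw [sum_congr rfl h3, sum_const, smul_eq_mul]
  simp only [Nat.descFactorial_succ, Nat.descFactorial_zero]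
  simp only [Nat.sub_zero, mul_one]
  ring

theorem quadAvg_nonneg [Fintype α] (G : Finset (Finset α)) (U : Finset α) : 0 ≤ quadAvg G U :=
  div_nonneg (sum_nonneg fun _ _ => quadWeight_nonneg _ _ _ _ _) (Nat.cast_nonneg _)

theorem tripleAvg_eq_avg [Fintype α] (G : Finset (Finset α)) {U : Finset α} (hU : 3 < #U) :
    (#U : ℝ) * tripleAvg G U = ∑ v ∈ U, tripleAvg G (U.erase v) := by
  refine subAvg_eq_avg (fun p hp => ?_) _ hU
  simp only [triples, mem_filter, mem_univ, true_and] at hp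
  exact card_eq_three.2 ⟨_, _, _, hp.1, hp.2.1, hp.2.2, rfl⟩

theorem sum_quadAvg_erase_le [Fintype α] (G : Finset (Finset α)) {U : Finset α} (hU : 3 < #U) :
    ∑ v ∈ U, quadAvg G (U.erase v) ≤ (#U : ℝ) * quadAvg G U := by
  rcases Nat.lt_or_ge 4 #U with h4 | h4
  · refine (subAvg_eq_avg (fun p hp => ?_) _ h4).ge
    simp only [quads, mem_filter, mem_univ, true_and] at hp
    obtain ⟨⟨h1, h2, h3⟩, ⟨h4, h5⟩, h6⟩ := hp
    rw [card_insert_of_notMem, card_eq_three.2 ⟨_, _, _, h4, h5, h6, rfl⟩]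
    simp [h1, h2, h3]
  · have h0 : ∀ v ∈ U, quadAvg G (U.erase v) = 0 := by
      intro v hv
      have : (#(U.erase v)).descFactorial 4 = 0 := by
        rw [Nat.descFactorial_eq_zero_iff_lt, card_erase_of_mem hv]; omega
      rw [quadAvg, subAvg, this, Nat.cast_zero, div_zero]
    rw [sum_eq_zero h0]
    exact mul_nonneg (Nat.cast_nonneg _) (quadAvg_nonneg G U)

end Weights
/-! ### Reduction of the Lubell function to local weights -/

section Local

variable {α : Type*} [DecidableEq α] [Fintype α]

theorem tripleAvg_eq (G : Finset (Finset α)) (U : Finset α) :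
    tripleAvg G U = (∑ a ∈ U, ∑ b ∈ U, ∑ c ∈ U,
      if a ≠ b ∧ a ≠ c ∧ b ≠ c then tripleWeight G a b c else 0) / (#U).descFactorial 3 := by
  rw [tripleAvg, subAvg, sum_triples]

theorem descFactorial_three_pos {m : ℕ} (hm : 3 ≤ m) : (0 : ℝ) < m.descFactorial 3 := by
  exact_mod_cast Nat.descFactorial_pos.2 hm

theorem cast_descFactorial_three {m : ℕ} (hm : 3 ≤ m) :
    (m.descFactorial 3 : ℝ) = m * (m - 1) * (m - 2) := by
  obtain ⟨k, rfl⟩ := Nat.exists_eq_add_of_le' hm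
  simp only [Nat.descFactorial_succ, Nat.descFactorial_zero]
  push_cast [show k + 3 - 2 = k + 1 by omega, show k + 3 - 1 = k + 2 by omega]
  ring

/-- If `G` has neither singletons nor pairs inside `U`, all points are white and there are no
edges. -/
theorem tripleAvg_eq_zero {G : Finset (Finset α)} {U : Finset α}
    (h1 : ∀ a ∈ U, {a} ∉ G) (h2 : ∀ a ∈ U, ∀ b ∈ U, {a, b} ∉ G) : tripleAvg G U = 0 := by
  rw [tripleAvg_eq]
  rw [sum_eq_zero, zero_div]
  refine fun a ha => sum_eq_zero fun b hb => sum_eq_zero fun c hc => ?_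
  have e1 : ∀ x ∈ U, ∀ y ∈ U, edge G x y = 0 := fun x hx y hy => by simp [edge, h2 x hx y hy]
  simp [tripleWeight, red, h1 a ha, e1 a ha b hb]

theorem quadAvg_eq_quarter {G : Finset (Finset α)} {U : Finset α} (hU : 4 ≤ #U)
    (h1 : ∀ a ∈ U, {a} ∉ G) (h2 : ∀ a ∈ U, ∀ b ∈ U, {a, b} ∉ G) : quadAvg G U = 1 / 4 := by
  have e1 : ∀ x ∈ U, ∀ y ∈ U, edge G x y = 0 := fun x hx y hy => by simp [edge, h2 x hx y hy]
  have w1 : ∀ x ∈ U, white G x = 1 := fun x hx => by simp [white, red, h1 x hx]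
  have h : ∀ p ∈ (quads α).filter
      (fun p => ({p.1, p.2.1, p.2.2.1, p.2.2.2} : Finset α) ⊆ U),
      quadWeight G p.1 p.2.1 p.2.2.1 p.2.2.2 = 1 / 4 := by
    intro p hp
    simp only [mem_filter, insert_subset_iff, singleton_subset_iff] at hp
    obtain ⟨-, ha, hb, hc, hd⟩ := hp
    simp [quadWeight, e1 _ ha _ hb, e1 _ ha _ hc, e1 _ ha _ hd, e1 _ hb _ hc, e1 _ hb _ hd,
      w1 _ ha, w1 _ hb, w1 _ hc, w1 _ hd]
  have hpos : (0 : ℝ) < (#U).descFactorial 4 := by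
    exact_mod_cast Nat.descFactorial_pos.2 hU
  rw [quadAvg, subAvg, sum_congr rfl h, sum_const, card_quads, nsmul_eq_mul]
  field_simp

/-- If `{u}` and `U` are the only members of `G` inside `U`, then `tripleAvg` is exactly the
contribution `1 / #U` of `{u}` to the Lubell function. -/
theorem tripleAvg_of_singleton {G : Finset (Finset α)} {U : Finset α} {u : α} (hU : 3 ≤ #U)
    (hu : u ∈ U) (hG : ∀ B ∈ G, B ⊆ U → #B < 3 → B = {u}) (huG : {u} ∈ G) :
    tripleAvg G U = 1 / #U := by
  have hr : ∀ x ∈ U, red G x = if u = x then 1 else 0 := by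
    intro x hx
    unfold red
    refine if_congr ⟨fun h => ?_, fun h => h ▸ huG⟩ rfl rfl
    simpa [eq_comm] using hG _ h (by simpa using hx) (by simp)
  have hp : ∀ x ∈ U, ∀ y ∈ U, x ≠ y → {x, y} ∉ G := by
    intro x hx y hy hxy h
    have := hG _ h (by simp [insert_subset_iff, hx, hy]) (by rw [card_pair hxy]; omega)
    have := congrArg card this
    rw [card_pair hxy, card_singleton] at this
    omega
  have key : ∀ a ∈ U, ∑ b ∈ U, ∑ c ∈ U,
      (if a ≠ b ∧ a ≠ c ∧ b ≠ c then tripleWeight G a b c else 0) =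
      if u = a then ((#U : ℝ) - 1) * (#U - 2) else 0 := by
    intro a ha
    split_ifs with hua
    · subst hua
      have h1 : ∀ b ∈ U, ∑ c ∈ U,
          (if u ≠ b ∧ u ≠ c ∧ b ≠ c then tripleWeight G u b c else 0) =
          if u ≠ b then ((#U - 2 : ℕ) : ℝ) else 0 := by
        intro b hb
        split_ifs with hub
        · rw [← sum_ne_two ha hb hub, Nat.cast_sum]
          refine sum_congr rfl fun c hc => ?_
          by_cases hc' : u ≠ c ∧ b ≠ c
          · rw [if_pos ⟨hub, hc'⟩, if_pos hc']
            simp [tripleWeight, miss, edge, white, hr u ha, hr b hb, hr c hc, hub, hc'.1,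
              hp u ha b hb hub, hp u ha c hc hc'.1, hp b hb c hc hc'.2]
            norm_num
          · rw [if_neg (by tauto), if_neg hc', Nat.cast_zero]
        · exact sum_eq_zero fun c _ => if_neg (by tauto)
      rw [sum_congr rfl h1]
      have h2 : ∀ b ∈ U, (if u ≠ b then ((#U - 2 : ℕ) : ℝ) else 0) =
          ((if u ≠ b then 1 else 0 : ℕ) : ℝ) * ((#U - 2 : ℕ) : ℝ) := by
        intro b _; split_ifs <;> simp
      rw [sum_congr rfl h2, ← sum_mul, ← Nat.cast_sum, sum_ne_one ha, Nat.cast_sub (by omega),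
        Nat.cast_sub (by omega)]
      norm_num
    · refine sum_eq_zero fun b hb => sum_eq_zero fun c hc => ?_
      split_ifs with hd
      · simp [tripleWeight, edge, hr a ha, hua, hp a ha b hb hd.1]
      · rfl
  rw [tripleAvg_eq, sum_congr rfl key, sum_ite_eq, if_pos hu, cast_descFactorial_three hU]
  have h3 : (3 : ℝ) ≤ #U := by exact_mod_cast hU
  have : (#U : ℝ) - 1 ≠ 0 := by linarith
  have : (#U : ℝ) - 2 ≠ 0 := by linarith
  field_simp

/-- If `{p, q}` and `U` are the only members of `G` inside `U`, then `tripleAvg` is exactly the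
contribution of `{p, q}` to the Lubell function. -/
theorem tripleAvg_of_pair {G : Finset (Finset α)} {U : Finset α} {p q : α} (hU : 3 ≤ #U)
    (hp : p ∈ U) (hq : q ∈ U) (hpq : p ≠ q)
    (hG : ∀ B ∈ G, B ⊆ U → #B < 3 → B = {p, q}) (hpG : {p, q} ∈ G) :
    tripleAvg G U = 2 / (#U * (#U - 1)) := by
  have hr : ∀ x ∈ U, red G x = 0 := by
    intro x hx
    unfold red
    refine if_neg fun h => ?_
    have := congrArg card (hG _ h (by simpa using hx) (by simp))
    rw [card_pair hpq, card_singleton] at this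
    omega
  have he : ∀ x ∈ U, ∀ y ∈ U, x ≠ y →
      edge G x y = if x = p ∧ y = q ∨ x = q ∧ y = p then 1 else 0 := by
    intro x hx y hy hxy
    have : {x, y} ∈ G ↔ x = p ∧ y = q ∨ x = q ∧ y = p := by
      constructor
      · intro h
        have := hG _ h (by simp [insert_subset_iff, hx, hy]) (by rw [card_pair hxy]; omega)
        have h1 : x ∈ ({p, q} : Finset α) := this ▸ by simp
        have h2 : y ∈ ({p, q} : Finset α) := this ▸ by simp
        rw [mem_insert, mem_singleton] at h1 h2
        rcases h1 with rfl | rfl <;> rcases h2 with rfl | rfl <;> simp_all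
      · rintro (⟨rfl, rfl⟩ | ⟨rfl, rfl⟩)
        · exact hpG
        · rwa [pair_comm]
    simp [edge, white, hr x hx, hr y hy, this]
  have h1 : ∀ a ∈ U, ∀ b ∈ U, ∑ c ∈ U,
      (if a ≠ b ∧ a ≠ c ∧ b ≠ c then tripleWeight G a b c else 0) =
      if a = p ∧ b = q ∨ a = q ∧ b = p then ((#U - 2 : ℕ) : ℝ) else 0 := by
    intro a ha b hb
    split_ifs with hab
    · have hne : a ≠ b := by grind
      rw [← sum_ne_two ha hb hne, Nat.cast_sum]
      refine sum_congr rfl fun c hc => ?_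
      by_cases hc' : a ≠ c ∧ b ≠ c
      · rw [if_pos ⟨hne, hc'⟩, if_pos hc']
        have e1 : edge G a b = 1 := by rw [he a ha b hb hne, if_pos hab]
        have e2 : edge G a c = 0 := by rw [he a ha c hc hc'.1, if_neg (by grind)]
        simp [tripleWeight, hr a ha, e1, e2, white, hr c hc]
      · rw [if_neg (by tauto), if_neg hc', Nat.cast_zero]
    · refine sum_eq_zero fun c hc => ?_
      split_ifs with hd
      · have e1 : edge G a b = 0 := by rw [he a ha b hb hd.1, if_neg hab]
        simp [tripleWeight, hr a ha, e1]
      · rfl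
  have h2 : ∑ a ∈ U, ∑ b ∈ U,
      (if a = p ∧ b = q ∨ a = q ∧ b = p then ((#U - 2 : ℕ) : ℝ) else 0) =
      2 * ((#U - 2 : ℕ) : ℝ) := by
    have : ∀ a b, (if a = p ∧ b = q ∨ a = q ∧ b = p then ((#U - 2 : ℕ) : ℝ) else 0) =
        (if p = a then if q = b then ((#U - 2 : ℕ) : ℝ) else 0 else 0) +
        (if q = a then if p = b then ((#U - 2 : ℕ) : ℝ) else 0 else 0) := by
      intro a b
      split_ifs <;> grind
    simp_rw [this, sum_add_distrib]
    have aux : ∀ (x y : α) (hx : x ∈ U) (hy : y ∈ U), ∑ a ∈ U, ∑ b ∈ U,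
        (if x = a then if y = b then ((#U - 2 : ℕ) : ℝ) else 0 else 0) = ((#U - 2 : ℕ) : ℝ) := by
      intro x y hx hy
      have : ∀ a ∈ U, ∑ b ∈ U, (if x = a then if y = b then ((#U - 2 : ℕ) : ℝ) else 0 else 0) =
          if x = a then ((#U - 2 : ℕ) : ℝ) else 0 := by
        intro a _
        split_ifs
        · rw [sum_ite_eq, if_pos hy]
        · simp
      rw [sum_congr rfl this, sum_ite_eq, if_pos hx]
    rw [aux p q hp hq, aux q p hq hp]
    ring
  rw [tripleAvg_eq, sum_congr rfl fun a ha => sum_congr rfl (h1 a ha), h2,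
    cast_descFactorial_three hU, Nat.cast_sub (by omega)]
  have h3 : (3 : ℝ) ≤ #U := by exact_mod_cast hU
  have : (#U : ℝ) - 1 ≠ 0 := by linarith
  have : (#U : ℝ) - 2 ≠ 0 := by linarith
  push_cast
  field_simp

/-- If `U ∈ G`, then `G` has at most one further member `B` inside `U`. For `#B ≤ 2` the triples
account for `B` exactly; otherwise `U` spans no red points and no edges, and `quadAvg = 1 / 4`. -/
theorem lubell_le_of_mem {G : Finset (Finset α)} (hG : IsWedgeFree G) {U : Finset α}
    (hU : 3 ≤ #U) (hUG : U ∈ G) : lubell G U ≤ 1 + tripleAvg G U + quadAvg G U := by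
  have h3 : (3 : ℝ) ≤ #U := by exact_mod_cast hU
  by_cases hB : ∃ B ∈ G, B ⊂ U
  · obtain ⟨B, hBG, hBU⟩ := hB
    have hall : ∀ C ∈ G, C ⊆ U → C = B ∨ C = U := fun C hC hCU => by
      rcases eq_or_ssubset_of_subset hCU with h | h
      · exact Or.inr h
      · exact Or.inl (hG.2 U hUG C hC B hBG h hBU)
    have hsmall : ∀ C ∈ G, C ⊆ U → #C < 3 → C = B := fun C hC hCU h =>
      (hall C hC hCU).resolve_right fun h' => by subst h'; omega
    have hfil : G.filter (fun C => C ⊆ U) = {B, U} := by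
      ext C
      simp only [mem_filter, mem_insert, mem_singleton]
      refine ⟨fun h => hall C h.1 h.2, ?_⟩
      rintro (h | h) <;> rw [h]
      exacts [⟨hBG, hBU.subset⟩, ⟨hUG, Subset.rfl⟩]
    have hL : lubell G U = ((#U).choose #B : ℝ)⁻¹ + 1 := by
      rw [lubell, hfil, sum_pair hBU.ne]; simp
    have hlt := card_lt_card hBU
    have hB0 : #B ≠ 0 := fun h => hG.1 (card_eq_zero.1 h ▸ hBG)
    have hq := quadAvg_nonneg G U
    rcases (show #B = 1 ∨ #B = 2 ∨ 3 ≤ #B by omega) with hc | hc | hc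
    · obtain ⟨u, rfl⟩ := card_eq_one.1 hc
      rw [tripleAvg_of_singleton hU (by simpa using hBU.subset) hsmall hBG, hL, hc]
      simp only [Nat.choose_one_right, one_div]
      linarith
    · obtain ⟨p, q, hpq, rfl⟩ := card_eq_two.1 hc
      have := hBU.subset
      rw [insert_subset_iff, singleton_subset_iff] at this
      rw [tripleAvg_of_pair hU this.1 this.2 hpq hsmall hBG, hL, hc, Nat.cast_choose_two, inv_div]
      linarith
    · have h1 : ∀ a ∈ U, {a} ∉ G := fun a ha h => by
        have := congrArg card (hsmall _ h (by simpa using ha) (by simp))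
        rw [card_singleton] at this; omega
      have h2 : ∀ a ∈ U, ∀ b ∈ U, {a, b} ∉ G := fun a ha b hb h => by
        have h5 := card_le_two (a := a) (b := b)
        have := congrArg card (hsmall _ h (by simp [insert_subset_iff, ha, hb]) (by omega))
        omega
      rw [tripleAvg_eq_zero h1 h2, quadAvg_eq_quarter (by omega) h1 h2, hL]
      -- a nontrivial binomial coefficient of an integer at least `4` is at least `4`
      have h4 : 4 ≤ (#U).choose #B := by
        have := Nat.choose_le_choose #B (show #B + 1 ≤ #U by omega)
        rw [Nat.choose_succ_self_right] at this
        omega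
      have h4' : (4 : ℝ) ≤ (#U).choose #B := by exact_mod_cast h4
      have : ((#U).choose #B : ℝ)⁻¹ ≤ 4⁻¹ := inv_anti₀ (by norm_num) h4'
      linarith
  · push Not at hB
    have hfil : G.filter (fun C => C ⊆ U) = {U} := by
      ext C
      simp only [mem_filter, mem_singleton]
      refine ⟨fun h => ?_, fun h => by rw [h]; exact ⟨hUG, Subset.rfl⟩⟩
      exact (eq_or_ssubset_of_subset h.2).resolve_right (hB C h.1)
    have hne : ∀ C ∈ G, C ⊆ U → ¬ #C < 3 := fun C hC hCU h => by
      rcases eq_or_ssubset_of_subset hCU with h' | h'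
      · subst h'; omega
      · exact hB C hC h'
    have h1 : ∀ a ∈ U, {a} ∉ G := fun a ha h => hne _ h (by simpa using ha) (by simp)
    have h2 : ∀ a ∈ U, ∀ b ∈ U, {a, b} ∉ G := fun a ha b hb h =>
      hne _ h (by simp [insert_subset_iff, ha, hb]) (by have := card_le_two (a := a) (b := b); omega)
    have hq := quadAvg_nonneg G U
    rw [tripleAvg_eq_zero h1 h2, lubell, hfil, sum_singleton]
    simp
    exact hq

/-- The defining property of `tripleWeight`, by inspection of all configurations on a triple. -/
theorem lubell_le_of_card_eq_three {G : Finset (Finset α)} (hG : IsWedgeFree G) {U : Finset α}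
    (hU : #U = 3) (hUG : U ∉ G) : lubell G U ≤ 1 + tripleAvg G U := by
  obtain ⟨a, b, c, hab, hac, hbc, rfl⟩ := card_eq_three.1 hU
  have hL : lubell G {a, b, c} = ∑ B ∈ ({a, b, c} : Finset α).powerset,
      if B ∈ G then ((Nat.choose 3 #B : ℕ) : ℝ)⁻¹ else 0 := by
    rw [lubell, hU, ← sum_filter]
    refine sum_congr ?_ fun _ _ => rfl
    ext B; simp [mem_powerset, and_comm]
  have hred : ∀ x y, x ≠ y → {x} ∈ G → {y} ∈ G → {x, y} ∉ G := by
    intro x y hxy hx hy h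
    have := hG.2 _ h _ hx _ hy
      (Finset.ssubset_iff_subset_ne.2 ⟨by simp, fun h' => by
        have := congrArg card h'; rw [card_pair hxy, card_singleton] at this; omega⟩)
      (Finset.ssubset_iff_subset_ne.2 ⟨by simp, fun h' => by
        have := congrArg card h'; rw [card_pair hxy, card_singleton] at this; omega⟩)
    exact hxy (singleton_injective this)
  have h0 := hG.1
  have hb := hred a b hab
  have hc := hred a c hac
  have hd := hred b c hbc
  have hL' : lubell G {a, b, c} = ((if {a} ∈ G then 1 else 0) + (if {b} ∈ G then 1 else 0) +
      (if {c} ∈ G then 1 else 0) + (if {a, b} ∈ G then 1 else 0) +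
      (if {a, c} ∈ G then 1 else 0) + (if {b, c} ∈ G then 1 else 0)) / 3 := by
    have hpow : ∀ g : Finset α → ℝ, ∑ t ∈ ({c} : Finset α).powerset, g t = g ∅ + g {c} := by
      intro g
      rw [← insert_empty_eq c, sum_powerset_insert (notMem_empty c)]
      simp
    rw [hL, sum_powerset_insert (by simp [hab, hac]), sum_powerset_insert (by simpa using hbc),
      sum_powerset_insert (by simpa using hbc)]
    simp only [hpow, insert_empty_eq, h0, hUG, card_singleton, card_pair hab,
      card_pair hac, card_pair hbc, if_false]
    simp only [Nat.choose_one_right, show Nat.choose 3 2 = 3 from rfl]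
    split_ifs <;> norm_num
  have hT : ∑ x ∈ {a, b, c}, ∑ y ∈ {a, b, c}, ∑ z ∈ {a, b, c},
      (if x ≠ y ∧ x ≠ z ∧ y ≠ z then tripleWeight G x y z else 0) =
      tripleWeight G a b c + tripleWeight G a c b + tripleWeight G b a c +
      tripleWeight G b c a + tripleWeight G c a b + tripleWeight G c b a := by
    have ha : a ∉ ({b, c} : Finset α) := by simp [hab, hac]
    have hb' : b ∉ ({c} : Finset α) := by simpa using hbc
    simp only [sum_insert ha, sum_insert hb', sum_singleton]
    simp [hab, hac, hbc, hab.symm, hac.symm, hbc.symm]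
    ring
  rw [hL', tripleAvg_eq, hU, hT]
  simp only [tripleWeight, miss, edge, white, red, pair_comm c a, pair_comm c b, pair_comm b a,
    show ((Nat.descFactorial 3 3 : ℕ) : ℝ) = 6 by norm_num [Nat.descFactorial]]
  by_cases ha : {a} ∈ G <;> by_cases hb1 : {b} ∈ G <;> by_cases hc1 : {c} ∈ G <;>
  by_cases hab1 : {a, b} ∈ G <;> by_cases hac1 : {a, c} ∈ G <;> by_cases hbc1 : {b, c} ∈ G <;>
  first
    | exact absurd hab1 (hb ha hb1)
    | exact absurd hac1 (hc ha hc1)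
    | exact absurd hbc1 (hd hb1 hc1)
    | (simp only [ha, hb1, hc1, hab1, hac1, hbc1, if_true, if_false]; norm_num)

/-- **Reduction to three and four points.** The Lubell function on a large cube is bounded by
averages of the local weights. Deleting points from the top leaves the average of the Lubell
function unchanged until a member of `G` is met. -/
theorem lubell_le_tripleAvg_add_quadAvg {G : Finset (Finset α)} (hG : IsWedgeFree G)
    {U : Finset α} (hU : 3 ≤ #U) : lubell G U ≤ 1 + tripleAvg G U + quadAvg G U := by
  induction U using Finset.strongInduction with
  | H U ih =>
    by_cases hUG : U ∈ G
    · exact lubell_le_of_mem hG hU hUG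
    rcases hU.eq_or_lt with h3 | h3
    · have := lubell_le_of_card_eq_three hG h3.symm hUG
      linarith [quadAvg_nonneg G U]
    · have h1 := lubell_eq_avg hUG
      have h2 := tripleAvg_eq_avg G h3
      have h4 := sum_quadAvg_erase_le G h3
      have h5 : ∑ v ∈ U, lubell G (U.erase v) ≤
          ∑ v ∈ U, (1 + tripleAvg G (U.erase v) + quadAvg G (U.erase v)) :=
        sum_le_sum fun v hv => ih _ (erase_ssubset hv) (by rw [card_erase_of_mem hv]; omega)
      rw [sum_add_distrib, sum_add_distrib, sum_const, nsmul_eq_mul, ← h1, ← h2] at h5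
      have hpos : (0 : ℝ) < #U := by exact_mod_cast (by omega : 0 < #U)
      refine le_of_mul_le_mul_left ?_ hpos
      linarith

end Local
/-! ### A quartic inequality

The three estimates below maximise the limiting excess of the Lubell function in terms of the
density `x` of white points and the density `d` of edges at a white point. -/

theorem quartic_le_of_le_half (x d : ℝ) (hd : 0 ≤ d) (hx : d ≤ x) (h1 : x ≤ 1/2) :
    x * ((1-x)^2 + (1-x)*d + d*(x-d) + (x-d)*(x/2-d)^2) ≤ 0.281 := by
  have h2 : (x/2-d)^2 ≤ 1/16 := by nlinarith
  have h3 : (x-d)*(x/2-d)^2 ≤ (x-d)*(1/16) := mul_le_mul_of_nonneg_left h2 (by linarith)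
  have h4 : (1-x)^2 + (1-x)*d + d*(x-d) + (x-d)*(x/2-d)^2 ≤ 1 - x + 1/32 := by
    nlinarith
  have := mul_le_mul_of_nonneg_left h4 (hd.trans hx)
  nlinarith [sq_nonneg (x-1/2)]

theorem quartic_le_of_half_le (x d : ℝ) (hd : 0 ≤ d) (hx : d ≤ x) (h0 : 1/2 ≤ x) (h1 : x ≤ 1) :
    x * ((1-x)^2 + (1-x)*d + (1-x)*(x-d)*(2*x-1)+d*(x-d) + (x-d)*(x/2-d)^2) ≤ 0.281 := by
  obtain ⟨u, rfl⟩ : ∃ u, d = x - u := ⟨x - d, by ring⟩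
  obtain ⟨y, rfl⟩ : ∃ y, x = 1 - y := ⟨1 - x, by ring⟩
  have hu : 0 ≤ u := by linarith
  have hux : 0 ≤ 1 - y - u := by linarith
  have hy : 0 ≤ y := by linarith
  have hy2 : 0 ≤ 1/2 - y := by linarith
  -- The maximum over `u` is attained near `1/2 - 2y/3`. A multiple of the square around this point
  -- reduces the cubic in `u` to the linear function `P + l u`, which is tested at the endpoints.
  have key : 0 ≤ (u - (1/2 - 2/3*y))^2 * (1 + y/3 - u) := mul_nonneg (sq_nonneg _) (by linarith)
  obtain ⟨P, hP⟩ : ∃ P, P = y + (1/2 - 2/3*y)^2 * (1 + y/3) := ⟨_, rfl⟩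
  obtain ⟨l, hl⟩ : ∃ l, l = y/6 - 7/4*y^2 := ⟨_, rfl⟩
  have h3 : (1-y) * P ≤ 0.281 := by
    rw [hP]
    nlinarith [mul_nonneg hy hy2, sq_nonneg (y - 0.32), mul_nonneg (mul_nonneg hy hy2) hy, mul_nonneg hy (sq_nonneg (y-0.32)), mul_nonneg hy2 (sq_nonneg (y-0.32)), sq_nonneg (y^2 - 0.32*y), sq_nonneg ((y-0.32)*(y-1/2))]
  have h4 : (1-y) * (P + l * (1-y)) ≤ 0.281 := by
    rw [hP, hl]
    nlinarith [mul_nonneg hy hy2, sq_nonneg (y - 0.092), mul_nonneg (mul_nonneg hy hy2) hy, mul_nonneg hy (sq_nonneg (y-0.092)), mul_nonneg hy2 (sq_nonneg (y-0.092)), sq_nonneg (y^2 - 0.092*y), sq_nonneg ((y-0.092)*(y-1/2))]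
  have h5 : (1-y) * (P + l * u) ≤ 0.281 := by
    have h6 := mul_le_mul_of_nonneg_left h3 hux
    have h7 := mul_le_mul_of_nonneg_left h4 hu
    have h8 : (1-y) * ((1-y) * (P + l * u)) ≤ (1-y) * 0.281 := by linarith
    exact le_of_mul_le_mul_left h8 (by linarith)
  have h9 := mul_nonneg (show 0 ≤ 1 - y by linarith) key
  refine le_trans (le_of_sub_nonneg ?_) h5
  refine le_of_le_of_eq h9 ?_
  rw [hP, hl]; ring

/-- The homogeneous form of the two preceding bounds. -/
theorem quartic_le {n X D : ℝ} (hn : 0 < n) (hD : 0 ≤ D) (hDX : D ≤ X) (hX : X ≤ n) :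
    X * (n * (n - X) ^ 2 + n * (n - X) * D + (n - X) * (X - D) * max (2 * X - n) 0 +
      n * D * (X - D) + (X - D) * (X / 2 - D) ^ 2) ≤ 0.281 * n ^ 4 := by
  obtain ⟨x, rfl⟩ : ∃ x, X = n * x := ⟨X / n, by field_simp⟩
  obtain ⟨d, rfl⟩ : ∃ d, D = n * d := ⟨D / n, by field_simp⟩
  have hd : 0 ≤ d := nonneg_of_mul_nonneg_right hD hn
  have hdx : d ≤ x := le_of_mul_le_mul_left hDX hn
  have hx : x ≤ 1 := le_of_mul_le_mul_left (by simpa using hX) hn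
  have hn4 : 0 < n ^ 4 := by positivity
  rcases le_total x (1 / 2) with h | h
  · have := mul_le_mul_of_nonneg_left (quartic_le_of_le_half x d hd hdx h) hn4.le
    rw [max_eq_right (by nlinarith)]
    linarith
  · have := mul_le_mul_of_nonneg_left (quartic_le_of_half_le x d hd hdx h hx) hn4.le
    rw [max_eq_left (by nlinarith)]
    linarith

/-! ### Sums of the local weights -/

section Analysis

variable {α : Type*} [DecidableEq α]

/-- The number of edges at `a`. -/
noncomputable def deg (G : Finset (Finset α)) (U : Finset α) (a : α) : ℝ := ∑ b ∈ U, edge G a b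

/-- The number of common neighbours of `a` and `b`. -/
noncomputable def codeg (G : Finset (Finset α)) (U : Finset α) (a b : α) : ℝ :=
  ∑ c ∈ U, edge G a c * edge G b c

/-- The number of ordered induced cherries, with end points `a` and `b`. Degenerate cherries with
`a = b` are included, as all sums here run over tuples that need not be distinct. -/
noncomputable def cherries (G : Finset (Finset α)) (U : Finset α) : ℝ :=
  ∑ a ∈ U, ∑ b ∈ U, (1 - edge G a b) * codeg G U a b

/-- The number of pairs of missing pairs with a common red point whose white points are not
joined by an edge; the two white points may coincide. -/
noncomputable def openPairs (G : Finset (Finset α)) (U : Finset α) : ℝ :=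
  ∑ a ∈ U, ∑ b ∈ U, ∑ c ∈ U,
    red G a * white G b * white G c * (miss G a b * miss G a c * (1 - edge G b c))

variable (G : Finset (Finset α)) (U : Finset α)

theorem edge_nonneg (a b : α) : 0 ≤ edge G a b := by
  rcases edge_eq G a b with h | h <;> simp [h]

theorem edge_le_one (a b : α) : edge G a b ≤ 1 := by
  rcases edge_eq G a b with h | h <;> simp [h]

theorem white_nonneg (a : α) : 0 ≤ white G a := by
  rcases white_eq G a with h | h <;> simp [h]

theorem red_nonneg (a : α) : 0 ≤ red G a := by
  rcases red_eq G a with h | h <;> simp [h]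

theorem miss_nonneg (a b : α) : 0 ≤ miss G a b := by
  rcases miss_eq G a b with h | h <;> simp [h]

theorem edge_le_white (a b : α) : edge G a b ≤ white G b := by
  have := white_mul_edge' G a b
  rcases white_eq G b with h | h
  · rw [h, zero_mul] at this; rw [← this, h]
  · rw [h]; exact edge_le_one G a b

theorem deg_nonneg (a : α) : 0 ≤ deg G U a := sum_nonneg fun _ _ => edge_nonneg G _ _

theorem deg_le (a : α) : deg G U a ≤ ∑ b ∈ U, white G b :=
  sum_le_sum fun _ _ => edge_le_white G _ _

theorem white_mul_deg (a : α) : white G a * deg G U a = deg G U a := by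
  rw [deg, mul_sum]; simp_rw [white_mul_edge]

theorem codeg_nonneg (a b : α) : 0 ≤ codeg G U a b :=
  sum_nonneg fun _ _ => mul_nonneg (edge_nonneg G _ _) (edge_nonneg G _ _)

theorem cherries_nonneg : 0 ≤ cherries G U :=
  sum_nonneg fun a _ => sum_nonneg fun b _ =>
    mul_nonneg (sub_nonneg.2 (edge_le_one G a b)) (codeg_nonneg G U a b)

theorem sum_red_add_sum_white : ∑ a ∈ U, red G a + ∑ a ∈ U, white G a = #U := by
  rw [← sum_add_distrib]; simp [white]

theorem sum_tripleWeight :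
    ∑ a ∈ U, ∑ b ∈ U, ∑ c ∈ U, tripleWeight G a b c =
      (∑ a ∈ U, red G a) ^ 2 * ∑ a ∈ U, white G a +
      (∑ a ∈ U, red G a) * ∑ a ∈ U, deg G U a -
      2 * #U * ∑ a ∈ U, ∑ b ∈ U, miss G a b + 3 * openPairs G U +
      ∑ a ∈ U, deg G U a * (∑ b ∈ U, white G b - deg G U a) - 2 * cherries G U := by
  have s1 : ∑ a ∈ U, ∑ b ∈ U, ∑ c ∈ U, red G a * red G b * white G c =
      (∑ a ∈ U, red G a) ^ 2 * ∑ a ∈ U, white G a := by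
    simp_rw [← mul_sum, ← sum_mul, ← mul_sum, ← sum_mul]; ring
  have s2 : ∑ a ∈ U, ∑ b ∈ U, ∑ c ∈ U, red G b * miss G a c =
      (∑ a ∈ U, red G a) * ∑ a ∈ U, ∑ b ∈ U, miss G a b := by
    simp_rw [← mul_sum, ← sum_mul, ← mul_sum]
  have s3 : ∑ a ∈ U, ∑ b ∈ U, ∑ c ∈ U, red G a * edge G b c =
      (∑ a ∈ U, red G a) * ∑ a ∈ U, deg G U a := by
    simp_rw [← mul_sum, ← sum_mul, deg]
  have s4 : ∑ a ∈ U, ∑ b ∈ U, ∑ c ∈ U, miss G a b * white G c =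
      (∑ a ∈ U, white G a) * ∑ a ∈ U, ∑ b ∈ U, miss G a b := by
    simp_rw [← mul_sum, ← sum_mul]; ring
  have s6 : ∑ a ∈ U, ∑ b ∈ U, ∑ c ∈ U, edge G a b * (white G c - edge G a c) =
      ∑ a ∈ U, deg G U a * (∑ b ∈ U, white G b - deg G U a) := by
    simp_rw [← mul_sum, ← sum_mul, sum_sub_distrib, deg]
  have s7 : ∑ a ∈ U, ∑ b ∈ U, ∑ c ∈ U, edge G a b * edge G a c * (1 - edge G b c) =
      cherries G U := by
    rw [sum_comm]
    refine sum_congr rfl fun b _ => ?_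
    rw [sum_comm]
    refine sum_congr rfl fun c _ => ?_
    rw [codeg, mul_sum]
    refine sum_congr rfl fun a _ => ?_
    rw [edge_comm G a b, edge_comm G a c]; ring
  have hpt : ∀ a b c, tripleWeight G a b c =
      red G a * red G b * white G c - 2 * (red G b * miss G a c) + red G a * edge G b c -
      2 * (miss G a b * white G c) +
      3 * (red G a * white G b * white G c * (miss G a b * miss G a c * (1 - edge G b c))) +
      edge G a b * (white G c - edge G a c) -
      2 * (edge G a b * edge G a c * (1 - edge G b c)) := by
    intro a b c
    unfold tripleWeight
    linear_combination (-2 * red G b * white G c) * red_mul_miss G a c -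
      2 * red G b * white_mul_miss G a c + red G a * white G b * white_mul_edge' G b c +
      red G a * white_mul_edge G b c - 2 * white G b * white G c * red_mul_miss G a b -
      2 * white G c * white_mul_miss G a b - edge G a b * white_mul_edge' G a c
  have hk : ∀ (k : ℝ) (f : α → α → α → ℝ), ∑ a ∈ U, ∑ b ∈ U, ∑ c ∈ U, k * f a b c =
      k * ∑ a ∈ U, ∑ b ∈ U, ∑ c ∈ U, f a b c := fun k f => by simp_rw [mul_sum]
  simp only [hpt, sum_sub_distrib, sum_add_distrib, hk]
  rw [s1, s2, s3, s4, s7, ← openPairs, ← s6, ← sum_red_add_sum_white G U]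
  ring

theorem sum_white_sub_edge (a : α) :
    ∑ b ∈ U, white G a * white G b * (1 - edge G a b) =
      white G a * (∑ b ∈ U, white G b - deg G U a) := by
  have : ∀ b, white G a * white G b * (1 - edge G a b) =
      white G a * (white G b - edge G a b) := fun b => by
    linear_combination (-white G a) * white_mul_edge' G a b
  simp_rw [this, ← mul_sum, sum_sub_distrib, deg]

theorem sum_common_nonneighbours (a b : α) :
    ∑ c ∈ U, white G c * (1 - edge G a c) * (1 - edge G b c) =
      ∑ c ∈ U, white G c - deg G U a - deg G U b + codeg G U a b := by
  rw [deg, deg, codeg, ← sum_sub_distrib, ← sum_sub_distrib, ← sum_add_distrib]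
  refine sum_congr rfl fun c _ => ?_
  linear_combination (edge G b c - 1) * white_mul_edge' G a c - white_mul_edge' G b c

/-- Fixing two nonadjacent white points, the other two are common non-neighbours of them, of which
there are `k = X - deg a - deg b + codeg a b`. As `0 ≤ k ≤ X`, the square `k ^ 2` exceeds
`(X - deg a - deg b) ^ 2` by at most `2 X codeg a b`, which is paid for by the induced cherries. -/
theorem sum_quadWeight_le :
    ∑ a ∈ U, ∑ b ∈ U, ∑ c ∈ U, ∑ d ∈ U, quadWeight G a b c d ≤
      ∑ a ∈ U, white G a * (∑ b ∈ U, white G b - deg G U a) *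
        ((∑ b ∈ U, white G b) / 2 - deg G U a) ^ 2 + (∑ b ∈ U, white G b) / 2 * cherries G U := by
  set X := ∑ b ∈ U, white G b with hX
  have h1 : ∀ a b, ∑ c ∈ U, ∑ d ∈ U, quadWeight G a b c d =
      1 / 4 * (white G a * white G b * (1 - edge G a b)) *
        (X - deg G U a - deg G U b + codeg G U a b) ^ 2 := by
    intro a b
    rw [hX, ← sum_common_nonneighbours, sq, sum_mul_sum, mul_sum]
    refine sum_congr rfl fun c _ => ?_
    rw [mul_sum]
    exact sum_congr rfl fun d _ => by rw [quadWeight]; ring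
  have h2 : ∀ a b, 1 / 4 * (white G a * white G b * (1 - edge G a b)) *
        (X - deg G U a - deg G U b + codeg G U a b) ^ 2 ≤
      white G a * white G b * (1 - edge G a b) * (1 / 2 * (X / 2 - deg G U a) ^ 2) +
      white G a * white G b * (1 - edge G a b) * (1 / 2 * (X / 2 - deg G U b) ^ 2) +
      X / 2 * ((1 - edge G a b) * codeg G U a b) := by
    intro a b
    have hk0 : 0 ≤ X - deg G U a - deg G U b + codeg G U a b := by
      rw [hX, ← sum_common_nonneighbours]
      exact sum_nonneg fun c _ => mul_nonneg (mul_nonneg (white_nonneg G c)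
        (sub_nonneg.2 (edge_le_one G a c))) (sub_nonneg.2 (edge_le_one G b c))
    have hkX : X - deg G U a - deg G U b + codeg G U a b ≤ X := by
      rw [hX, ← sum_common_nonneighbours]
      refine sum_le_sum fun c _ => ?_
      rcases white_eq G c with h | h <;> rcases edge_eq G a c with h' | h' <;>
        rcases edge_eq G b c with h'' | h'' <;> simp [h, h', h'']
    have hc := codeg_nonneg G U a b
    have hda := deg_nonneg G U a
    have hdb := deg_nonneg G U b
    have hX0 : 0 ≤ X := sum_nonneg fun b _ => white_nonneg G b
    have he : 0 ≤ 1 - edge G a b := sub_nonneg.2 (edge_le_one G a b)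
    have hY : 0 ≤ X / 2 * ((1 - edge G a b) * codeg G U a b) := by positivity
    have hmain : 1 / 4 * (X - deg G U a - deg G U b + codeg G U a b) ^ 2 ≤
        1 / 2 * (X / 2 - deg G U a) ^ 2 + 1 / 2 * (X / 2 - deg G U b) ^ 2 +
          X / 2 * codeg G U a b := by
      nlinarith [sq_nonneg (deg G U a - deg G U b), mul_nonneg hc (sub_nonneg.2 hkX),
        mul_nonneg hc hda, mul_nonneg hc hdb]
    rcases white_eq G a with h | h
    · simpa [h] using hY
    rcases white_eq G b with h' | h'
    · simpa [h'] using hY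
    rw [h, h']
    have := mul_le_mul_of_nonneg_left hmain he
    linarith
  have h3 : ∑ a ∈ U, ∑ b ∈ U,
      white G a * white G b * (1 - edge G a b) * (1 / 2 * (X / 2 - deg G U a) ^ 2) =
      1 / 2 * ∑ a ∈ U, white G a * (X - deg G U a) * (X / 2 - deg G U a) ^ 2 := by
    simp_rw [← sum_mul, sum_white_sub_edge]
    rw [mul_sum]
    exact sum_congr rfl fun a _ => by ring
  have h4 : ∑ a ∈ U, ∑ b ∈ U,
      white G a * white G b * (1 - edge G a b) * (1 / 2 * (X / 2 - deg G U b) ^ 2) =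
      1 / 2 * ∑ a ∈ U, white G a * (X - deg G U a) * (X / 2 - deg G U a) ^ 2 := by
    rw [← h3, sum_comm]
    refine sum_congr rfl fun a _ => sum_congr rfl fun b _ => ?_
    rw [edge_comm G b a, mul_comm (white G b)]
  simp_rw [h1]
  refine (sum_le_sum fun a _ => sum_le_sum fun b _ => h2 a b).trans (le_of_eq ?_)
  simp_rw [sum_add_distrib]
  rw [h3, h4, cherries]
  simp_rw [← mul_sum]
  ring

theorem openPairs_le_miss :
    openPairs G U ≤ (∑ a ∈ U, white G a) * ∑ a ∈ U, ∑ b ∈ U, miss G a b := by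
  have : (∑ a ∈ U, white G a) * ∑ a ∈ U, ∑ b ∈ U, miss G a b =
      ∑ a ∈ U, ∑ b ∈ U, ∑ c ∈ U, miss G a b * white G c := by
    simp_rw [← mul_sum, ← sum_mul]; ring
  rw [this]
  refine sum_le_sum fun a _ => sum_le_sum fun b _ => sum_le_sum fun c _ => ?_
  rcases red_eq G a with h1 | h1 <;> rcases white_eq G b with h2 | h2 <;>
    rcases white_eq G c with h3 | h3 <;> rcases miss_eq G a b with h4 | h4 <;>
    rcases miss_eq G a c with h5 | h5 <;> rcases edge_eq G b c with h6 | h6 <;>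
    simp [h1, h2, h3, h4, h5, h6]

theorem openPairs_le_nonedges :
    openPairs G U ≤ (∑ a ∈ U, red G a) *
      ((∑ a ∈ U, white G a) ^ 2 - ∑ a ∈ U, deg G U a) := by
  have : (∑ a ∈ U, red G a) * ((∑ a ∈ U, white G a) ^ 2 - ∑ a ∈ U, deg G U a) =
      ∑ a ∈ U, ∑ b ∈ U, ∑ c ∈ U, red G a * (white G b * white G c - edge G b c) := by
    simp_rw [← mul_sum, sum_sub_distrib, ← mul_sum, ← sum_mul, deg, sq]
  rw [this]
  refine sum_le_sum fun a _ => sum_le_sum fun b _ => sum_le_sum fun c _ => ?_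
  have hb := white_mul_edge G b c
  have hc := white_mul_edge' G b c
  rcases red_eq G a with h1 | h1 <;> rcases white_eq G b with h2 | h2 <;>
    rcases white_eq G c with h3 | h3 <;> rcases miss_eq G a b with h4 | h4 <;>
    rcases miss_eq G a c with h5 | h5 <;> rcases edge_eq G b c with h6 | h6 <;>
    simp_all

/-- **The local weights in the limit.** Up to terms of lower order, the two sums compute the
excess of the Lubell function over one. -/
theorem sum_tripleWeight_add_sum_quadWeight_le (hU : U.Nonempty) :
    (#U : ℝ) * ∑ a ∈ U, ∑ b ∈ U, ∑ c ∈ U, tripleWeight G a b c +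
      ∑ a ∈ U, ∑ b ∈ U, ∑ c ∈ U, ∑ d ∈ U, quadWeight G a b c d ≤ 0.281 * (#U : ℝ) ^ 4 := by
  have hn : (0 : ℝ) < #U := by exact_mod_cast hU.card_pos
  have hq := sum_quadWeight_le G U
  rw [sum_tripleWeight]
  have hRX := sum_red_add_sum_white G U
  have hZ1 := openPairs_le_miss G U
  have hZ2 := openPairs_le_nonedges G U
  have hK := cherries_nonneg G U
  have hM : 0 ≤ ∑ a ∈ U, ∑ b ∈ U, miss G a b :=
    sum_nonneg fun a _ => sum_nonneg fun b _ => miss_nonneg G a b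
  have hZ0 : 0 ≤ openPairs G U := by
    refine sum_nonneg fun a _ => sum_nonneg fun b _ => sum_nonneg fun c _ => ?_
    have := red_nonneg G a; have := white_nonneg G b; have := white_nonneg G c
    have := miss_nonneg G a b; have := miss_nonneg G a c
    have := sub_nonneg.2 (edge_le_one G b c)
    positivity
  have hR0 : 0 ≤ ∑ a ∈ U, red G a := sum_nonneg fun a _ => red_nonneg G a
  have hX0 : 0 ≤ ∑ a ∈ U, white G a := sum_nonneg fun a _ => white_nonneg G a
  set X := ∑ a ∈ U, white G a with hX
  set R := ∑ a ∈ U, red G a with hR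
  set M := ∑ a ∈ U, ∑ b ∈ U, miss G a b
  set Z := openPairs G U
  set K := cherries G U
  set n : ℝ := (#U : ℝ)
  set P := ∑ a ∈ U, deg G U a with hP
  have hRn : R = n - X := by linarith
  have hXn : X ≤ n := by linarith
  -- `2 n - X` approximates `n ^ 2 / X` from below, so that `Z ≤ X M` bounds `M` without division
  have hMZ : n * (-2 * n * M + 3 * Z) ≤ R * (X ^ 2 - P) * max (2 * X - n) 0 := by
    have h1 : (2 * n - X) * Z ≤ n ^ 2 * M := by
      nlinarith [mul_le_mul_of_nonneg_left hZ1 (show 0 ≤ 2 * n - X by linarith),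
        mul_nonneg hM (sq_nonneg (n - X))]
    have h2 : Z * (2 * X - n) ≤ Z * max (2 * X - n) 0 :=
      mul_le_mul_of_nonneg_left (le_max_left _ _) hZ0
    have h3 : Z * max (2 * X - n) 0 ≤ R * (X ^ 2 - P) * max (2 * X - n) 0 :=
      mul_le_mul_of_nonneg_right hZ2 (le_max_right _ _)
    linarith
  have hKn : X / 2 * K ≤ n * (2 * K) := by nlinarith
  have hpoint : ∑ a ∈ U, white G a * (n * (n - X) ^ 2 + n * (n - X) * deg G U a +
      (n - X) * (X - deg G U a) * max (2 * X - n) 0 + n * deg G U a * (X - deg G U a) +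
      (X - deg G U a) * (X / 2 - deg G U a) ^ 2) ≤ 0.281 * n ^ 4 := by
    rcases hX0.eq_or_lt with h0 | hpos
    · have : ∀ a ∈ U, white G a = 0 :=
        (sum_eq_zero_iff_of_nonneg fun a _ => white_nonneg G a).1 h0.symm
      rw [sum_eq_zero fun a ha => by rw [this a ha, zero_mul]]
      positivity
    · have : ∀ a ∈ U, white G a * (n * (n - X) ^ 2 + n * (n - X) * deg G U a +
          (n - X) * (X - deg G U a) * max (2 * X - n) 0 + n * deg G U a * (X - deg G U a) +
          (X - deg G U a) * (X / 2 - deg G U a) ^ 2) ≤ white G a * (0.281 * n ^ 4 / X) :=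
        fun a _ => mul_le_mul_of_nonneg_left ((le_div_iff₀' hpos).2
          (quartic_le hn (deg_nonneg G U a) (deg_le G U a) hXn)) (white_nonneg G a)
      refine (sum_le_sum this).trans (le_of_eq ?_)
      rw [← sum_mul, ← hX]
      field_simp
  have hsplit : ∑ a ∈ U, white G a * (n * (n - X) ^ 2 + n * (n - X) * deg G U a +
      (n - X) * (X - deg G U a) * max (2 * X - n) 0 + n * deg G U a * (X - deg G U a) +
      (X - deg G U a) * (X / 2 - deg G U a) ^ 2) =
      n * R ^ 2 * X + n * R * P + R * (X ^ 2 - P) * max (2 * X - n) 0 +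
      n * ∑ a ∈ U, deg G U a * (X - deg G U a) +
      ∑ a ∈ U, white G a * (X - deg G U a) * (X / 2 - deg G U a) ^ 2 := by
    have : ∀ a ∈ U, white G a * (n * (n - X) ^ 2 + n * (n - X) * deg G U a +
      (n - X) * (X - deg G U a) * max (2 * X - n) 0 + n * deg G U a * (X - deg G U a) +
      (X - deg G U a) * (X / 2 - deg G U a) ^ 2) =
      (n * R ^ 2 + R * X * max (2 * X - n) 0) * white G a +
      (n * R - R * max (2 * X - n) 0) * deg G U a + n * (deg G U a * (X - deg G U a)) +
      white G a * (X - deg G U a) * (X / 2 - deg G U a) ^ 2 := by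
      intro a _
      rw [hRn]
      linear_combination (n * (n - X) - (n - X) * max (2 * X - n) 0 + n * (X - deg G U a)) *
        white_mul_deg G U a
    rw [sum_congr rfl this, sum_add_distrib, sum_add_distrib, sum_add_distrib, ← mul_sum,
      ← mul_sum, ← mul_sum, ← hX, ← hP]
    ring
  rw [hsplit] at hpoint
  linarith

end Analysis
/-! ### Error terms -/

section ErrorTerms

variable {α : Type*} [DecidableEq α]

theorem neg_five_le_tripleWeight (G : Finset (Finset α)) (a b c : α) :
    -5 ≤ tripleWeight G a b c := by
  have h1 : -1 ≤ red G a * red G b * white G c * (1 - 2 * miss G a c) := by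
    rcases red_eq G a with h1 | h1 <;> rcases red_eq G b with h2 | h2 <;>
      rcases white_eq G c with h3 | h3 <;> rcases miss_eq G a c with h4 | h4 <;>
      norm_num [h1, h2, h3, h4]
  have h2 : -2 ≤ red G a * white G b * white G c *
      (edge G b c - 2 * miss G a b + 3 * (miss G a b * miss G a c * (1 - edge G b c))) := by
    rcases red_eq G a with h1 | h1 <;> rcases white_eq G b with h2 | h2 <;>
      rcases white_eq G c with h3 | h3 <;> rcases miss_eq G a b with h4 | h4 <;>
      rcases miss_eq G a c with h5 | h5 <;> rcases edge_eq G b c with h6 | h6 <;>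
      norm_num [h1, h2, h3, h4, h5, h6]
  have h3 : -2 ≤ edge G a b * white G c * (1 - edge G a c) -
      2 * (edge G a b * edge G a c * (1 - edge G b c)) := by
    rcases edge_eq G a b with h1 | h1 <;> rcases edge_eq G a c with h2 | h2 <;>
      rcases white_eq G c with h3 | h3 <;> rcases edge_eq G b c with h4 | h4 <;>
      norm_num [h1, h2, h3, h4]
  unfold tripleWeight
  linarith

theorem quadWeight_le_one (G : Finset (Finset α)) (a b c d : α) : quadWeight G a b c d ≤ 1 := by
  have hw : ∀ x, 0 ≤ white G x ∧ white G x ≤ 1 := fun x => by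
    rcases white_eq G x with h | h <;> simp [h]
  have he : ∀ x y, 0 ≤ 1 - edge G x y ∧ 1 - edge G x y ≤ 1 := fun x y => by
    rcases edge_eq G x y with h | h <;> simp [h]
  have hm : ∀ x y : ℝ, 0 ≤ x ∧ x ≤ 1 → 0 ≤ y ∧ y ≤ 1 → 0 ≤ x * y ∧ x * y ≤ 1 :=
    fun x y hx hy => ⟨mul_nonneg hx.1 hy.1, mul_le_one₀ hx.2 hy.1 hy.2⟩
  exact (hm _ _ (hm _ _ (hm _ _ ⟨by norm_num, by norm_num⟩ (hm _ _ (hm _ _ (hw a) (hw b))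
    (he a b))) (hm _ _ (hm _ _ (hw c) (he a c)) (he b c)))
    (hm _ _ (hm _ _ (hw d) (he a d)) (he b d))).2

/-- Dropping the distinctness condition costs only a quadratic number of triples. -/
theorem sum_distinct_le (G : Finset (Finset α)) (U : Finset α) :
    (∑ a ∈ U, ∑ b ∈ U, ∑ c ∈ U, if a ≠ b ∧ a ≠ c ∧ b ≠ c then tripleWeight G a b c else 0) ≤
      ∑ a ∈ U, ∑ b ∈ U, ∑ c ∈ U, tripleWeight G a b c + 15 * (#U : ℝ) ^ 2 := by
  have h : ∀ a b c, (if a ≠ b ∧ a ≠ c ∧ b ≠ c then tripleWeight G a b c else 0) ≤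
      tripleWeight G a b c +
        ((if a = b then 5 else 0) + (if a = c then 5 else 0) + (if b = c then 5 else 0)) := by
    intro a b c
    have := neg_five_le_tripleWeight G a b c
    split_ifs <;> first | tauto | linarith
  refine (sum_le_sum fun a _ => sum_le_sum fun b _ => sum_le_sum fun c _ => h a b c).trans
    (le_of_eq ?_)
  simp_rw [sum_add_distrib]
  have h1 : ∑ a ∈ U, ∑ b ∈ U, ∑ c ∈ U, (if a = b then 5 else 0 : ℝ) = 5 * (#U : ℝ) ^ 2 := by
    have : ∀ a ∈ U, ∑ b ∈ U, ∑ c ∈ U, (if a = b then 5 else 0 : ℝ) = 5 * #U := by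
      intro a ha
      simp_rw [sum_const, nsmul_eq_mul, ← mul_sum]
      rw [sum_ite_eq, if_pos ha, mul_comm]
    rw [sum_congr rfl this, sum_const, nsmul_eq_mul]; ring
  have h2 : ∑ a ∈ U, ∑ b ∈ U, ∑ c ∈ U, (if a = c then 5 else 0 : ℝ) = 5 * (#U : ℝ) ^ 2 := by
    rw [← h1]
    exact sum_congr rfl fun a _ => sum_comm
  have h3 : ∑ a ∈ U, ∑ b ∈ U, ∑ c ∈ U, (if b = c then 5 else 0 : ℝ) = 5 * (#U : ℝ) ^ 2 := by
    rw [← h2]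
    exact sum_comm
  rw [h1, h2, h3]; ring

theorem cast_descFactorial_four {m : ℕ} (hm : 4 ≤ m) :
    (m.descFactorial 4 : ℝ) = m * (m - 1) * (m - 2) * (m - 3) := by
  obtain ⟨k, rfl⟩ := Nat.exists_eq_add_of_le' hm
  simp only [Nat.descFactorial_succ, Nat.descFactorial_zero]
  push_cast [show k + 4 - 3 = k + 1 by omega, show k + 4 - 2 = k + 2 by omega,
    show k + 4 - 1 = k + 3 by omega]
  ring

/-- The bound `0.281` for the sums over all tuples passes to the averages over distinct tuples with
an error of at most `33 / #U`, which `20000 ≤ #U` makes smaller than `0.002`. -/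
theorem tripleAvg_add_quadAvg_le [Fintype α] (G : Finset (Finset α)) {U : Finset α} (hU : 20000 ≤ #U) :
    tripleAvg G U + quadAvg G U ≤ 0.283261 := by
  have hn : (20000 : ℝ) ≤ #U := by exact_mod_cast hU
  have hmain := sum_tripleWeight_add_sum_quadWeight_le G U (card_pos.1 (by omega))
  have hT : tripleAvg G U * (#U).descFactorial 3 ≤
      ∑ a ∈ U, ∑ b ∈ U, ∑ c ∈ U, tripleWeight G a b c + 15 * (#U : ℝ) ^ 2 := by
    rw [tripleAvg_eq, div_mul_cancel₀ _ (descFactorial_three_pos (by omega)).ne']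
    exact sum_distinct_le G U
  have hQ : quadAvg G U * (#U).descFactorial 4 ≤
      ∑ a ∈ U, ∑ b ∈ U, ∑ c ∈ U, ∑ d ∈ U, quadWeight G a b c d := by
    have : ((#U).descFactorial 4 : ℝ) ≠ 0 := by
      exact_mod_cast (Nat.descFactorial_pos.2 (by omega)).ne'
    rw [quadAvg, subAvg, div_mul_cancel₀ _ this]
    exact sum_quads_le (quadWeight_nonneg G) U
  have hQ0 : 0 ≤ ∑ a ∈ U, ∑ b ∈ U, ∑ c ∈ U, ∑ d ∈ U, quadWeight G a b c d :=
    sum_nonneg fun a _ => sum_nonneg fun b _ => sum_nonneg fun c _ => sum_nonneg fun d _ =>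
      quadWeight_nonneg G a b c d
  have hQ1 : ∑ a ∈ U, ∑ b ∈ U, ∑ c ∈ U, ∑ d ∈ U, quadWeight G a b c d ≤ (#U : ℝ) ^ 4 := by
    refine (sum_le_sum fun a _ => sum_le_sum fun b _ => sum_le_sum fun c _ => sum_le_sum
      fun d _ => quadWeight_le_one G a b c d).trans (le_of_eq ?_)
    simp only [sum_const, nsmul_eq_mul, mul_one]
    ring
  have hq0 := quadAvg_nonneg G U
  rw [cast_descFactorial_three (by omega)] at hT
  rw [cast_descFactorial_four (by omega)] at hQ
  generalize (∑ a ∈ U, ∑ b ∈ U, ∑ c ∈ U, tripleWeight G a b c) = T at *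
  generalize (∑ a ∈ U, ∑ b ∈ U, ∑ c ∈ U, ∑ d ∈ U, quadWeight G a b c d) = Q at *
  generalize tripleAvg G U = t at *
  generalize quadAvg G U = q at *
  generalize (#U : ℝ) = n at *
  have hn3 : (0 : ℝ) < n ^ 3 := by positivity
  have hTn : T ≤ 0.281 * n ^ 3 := by
    refine le_of_mul_le_mul_left (?_ : n * T ≤ n * _) (by linarith : (0 : ℝ) < n)
    linarith
  have ht2 : t ≤ 2 := by
    by_contra! h
    nlinarith [mul_pos (mul_pos (show 0 < n by linarith) (show 0 < n - 1 by linarith))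
      (show 0 < n - 2 by linarith), sq_nonneg n, mul_nonneg (sq_nonneg n) (show 0 ≤ n - 20000 by linarith)]
  have hp4 : n ^ 4 - 6 * n ^ 3 ≤ n * (n - 1) * (n - 2) * (n - 3) := by nlinarith
  have hq2 : q ≤ 2 := by
    by_contra! h
    have h1 : 2 * (n ^ 4 - 6 * n ^ 3) ≤ n ^ 4 := by
      have : 0 ≤ n ^ 4 - 6 * n ^ 3 := by nlinarith
      nlinarith
    nlinarith
  have hT' : t * n ^ 3 ≤ T + 21 * n ^ 2 := by
    have : t * (3 * n ^ 2 - 2 * n) ≤ 2 * (3 * n ^ 2 - 2 * n) :=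
      mul_le_mul_of_nonneg_right ht2 (by nlinarith)
    nlinarith
  have hQ' : q * n ^ 4 ≤ Q + 12 * n ^ 3 := by
    have h1 : q * (n ^ 4 - 6 * n ^ 3) ≤ Q := (mul_le_mul_of_nonneg_left hp4 hq0).trans hQ
    have h2 : q * (6 * n ^ 3) ≤ 2 * (6 * n ^ 3) := mul_le_mul_of_nonneg_right hq2 (by positivity)
    linarith
  have hT'' := mul_le_mul_of_nonneg_left hT' (show 0 ≤ n by linarith)
  have hsum : (t + q) * n ^ 4 ≤ 0.281 * n ^ 4 + 33 * n ^ 3 := by linarith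
  have h33 : 33 * n ^ 3 ≤ 0.002 * n ^ 4 := by nlinarith
  refine le_of_mul_le_mul_right (?_ : (t + q) * n ^ 4 ≤ _ * n ^ 4) (by positivity)
  have : 0 < n ^ 4 := by positivity
  linarith

end ErrorTerms

/-! ### Diamond-free families -/

section DiamondFree

variable {α : Type*} [DecidableEq α]

/-- `F` contains no four sets `A ⊂ B, C ⊂ D` with `B ≠ C`. -/
def IsDiamondFree (F : Finset (Finset α)) : Prop :=
  ∀ A ∈ F, ∀ B ∈ F, ∀ C ∈ F, ∀ D ∈ F, A ⊂ B → A ⊂ C → B ⊂ D → C ⊂ D → B = C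

/-- The complements in `U` of the members of `F` strictly below `U`. -/
def belowCompl (F : Finset (Finset α)) (U : Finset α) : Finset (Finset α) :=
  (F.filter (fun B => B ⊂ U)).image (fun B => U \ B)

/-- A diamond is turned upside down by complementation in its top set `U`, so the complement of
its bottom would contain two further members. -/
theorem isWedgeFree_belowCompl {F : Finset (Finset α)} (hF : IsDiamondFree F) {U : Finset α}
    (hU : U ∈ F) : IsWedgeFree (belowCompl F U) := by
  constructor
  · simp only [belowCompl, mem_image, mem_filter, not_exists, not_and, and_imp]
    intro B _ hBU h
    exact hBU.2 (sdiff_eq_empty_iff_subset.1 h)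
  · simp only [belowCompl, mem_image, mem_filter]
    rintro _ ⟨A, ⟨hA, hAU⟩, rfl⟩ _ ⟨B, ⟨hB, hBU⟩, rfl⟩ _ ⟨C, ⟨hC, hCU⟩, rfl⟩ hBA hCA
    have key : ∀ X, X ⊂ U → U \ X ⊂ U \ A → A ⊂ X := by
      intro X hX h
      exact ⟨fun a ha => by_contra fun hx =>
        (mem_sdiff.1 (h.1 (mem_sdiff.2 ⟨hAU.1 ha, hx⟩))).2 ha,
        fun hXA => h.2 (sdiff_subset_sdiff Subset.rfl hXA)⟩
    rw [hF A hA B hB C hC U hU (key B hBU hBA) (key C hCU hCA) hBU hCU]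

/-- Complementation in `U` preserves the Lubell function; `U` itself contributes one. -/
theorem lubell_eq_one_add {F : Finset (Finset α)} {U : Finset α} (hU : U ∈ F) :
    lubell F U = 1 + lubell (belowCompl F U) U := by
  have hinj : Set.InjOn (fun B => U \ B) (F.filter (fun B => B ⊂ U)) := by
    intro B hB C hC h
    rw [mem_coe, mem_filter] at hB hC
    rw [← Finset.sdiff_sdiff_eq_self hB.2.subset, ← Finset.sdiff_sdiff_eq_self hC.2.subset]
    exact congrArg (fun X => U \ X) h
  have h1 : (belowCompl F U).filter (fun D => D ⊆ U) = belowCompl F U := by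
    refine filter_true_of_mem fun D hD => ?_
    obtain ⟨B, -, rfl⟩ := mem_image.1 hD
    exact sdiff_subset
  have h2 : F.filter (fun B => B ⊆ U) = insert U (F.filter (fun B => B ⊂ U)) := by
    ext B
    simp only [mem_filter, mem_insert]
    constructor
    · rintro ⟨hB, h⟩
      exact (eq_or_ssubset_of_subset h).imp id fun h => ⟨hB, h⟩
    · rintro (h | h)
      · rw [h]; exact ⟨hU, Subset.rfl⟩
      · exact ⟨h.1, h.2.subset⟩
  rw [lubell, lubell, h1, h2, sum_insert (by simp), belowCompl, sum_image hinj]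
  congr 1
  · simp
  · refine sum_congr rfl fun B hB => ?_
    have hBU := (mem_filter.1 hB).2.subset
    rw [card_sdiff_of_subset hBU, Nat.choose_symm (card_le_card hBU)]

/-- Deleting points from the top until a member of `F` is met reduces the Lubell function of a
diamond-free family to that of a family containing the top set. -/
theorem lubell_le_of_isDiamondFree [Fintype α] {F : Finset (Finset α)} (hF : IsDiamondFree F)
    (hcard : ∀ B ∈ F, 20000 ≤ #B) (U : Finset α) : lubell F U ≤ 2.283261 := by
  induction U using Finset.strongInduction with
  | H U ih =>
    by_cases hUF : U ∈ F
    · have hU := hcard U hUF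
      have h1 := lubell_le_tripleAvg_add_quadAvg (isWedgeFree_belowCompl hF hUF)
        (show 3 ≤ #U by omega)
      have h2 := tripleAvg_add_quadAvg_le (belowCompl F U) hU
      rw [lubell_eq_one_add hUF]
      linarith
    · rcases U.eq_empty_or_nonempty with rfl | hne
      · have : F.filter (fun B => B ⊆ ∅) = ∅ := by
          refine filter_false_of_mem fun B hB h => ?_
          rw [subset_empty.1 h] at hB
          exact hUF hB
        rw [lubell, this, sum_empty]; norm_num
      · have h1 := lubell_eq_avg hUF
        have h2 : ∑ v ∈ U, lubell F (U.erase v) ≤ ∑ v ∈ U, (2.283261 : ℝ) :=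
          sum_le_sum fun v hv => ih _ (erase_ssubset hv)
        rw [← h1, sum_const, nsmul_eq_mul] at h2
        exact le_of_mul_le_mul_left h2 (by exact_mod_cast hne.card_pos)

end DiamondFree

theorem isDiamondFree_of_isFree {n : ℕ} {F : Finset (Q n)} (hF : IsFree (Q 2) F) :
    IsDiamondFree F := by
  intro A hA B hB C hC D hD hAB hAC hBD hCD
  by_contra hne
  refine hF ⟨fun X => if 0 ∈ X then (if 1 ∈ X then ⟨D, hD⟩ else ⟨B, hB⟩)
    else (if 1 ∈ X then ⟨C, hC⟩ else ⟨A, hA⟩), ?_, ?_⟩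
  · have hAD := hAB.trans hBD
    intro X Y h
    have hX : ∀ Z : Q 2, Z = if 0 ∈ Z then (if 1 ∈ Z then {0, 1} else {0})
      else (if 1 ∈ Z then {1} else ∅) := by decide
    rw [hX X, hX Y]
    clear hX
    have := hAB.ne; have := hAC.ne; have := hBD.ne; have := hCD.ne; have := hAD.ne
    dsimp only at h
    split_ifs at h ⊢ <;> first
      | rfl
      | exact absurd (congrArg Subtype.val h)
          (by first | assumption | (apply Ne.symm; assumption))
  · intro X Y hXY
    have h0 : (0 : Fin 2) ∈ X → (0 : Fin 2) ∈ Y := fun h => hXY h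
    have h1 : (1 : Fin 2) ∈ X → (1 : Fin 2) ∈ Y := fun h => hXY h
    have hAD := hAB.trans hBD
    dsimp only
    split_ifs <;> first
      | tauto
      | exact le_rfl
      | exact hAB.subset
      | exact hAC.subset
      | exact hBD.subset
      | exact hCD.subset
      | exact hAD.subset

/-! ### From the Lubell function to the extremal number -/

theorem card_le_lubell_mul (n : ℕ) (F : Finset (Q n)) :
    (#F : ℝ) ≤ lubell F univ * N n := by
  have hN : (0 : ℝ) < N n := by exact_mod_cast Nat.choose_pos (Nat.div_le_self n 2)
  rw [lubell, filter_true_of_mem fun B _ => subset_univ B, sum_mul, card_eq_sum_ones,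
    Nat.cast_sum]
  refine sum_le_sum fun B _ => ?_
  have hpos : (0 : ℝ) < n.choose #B := by
    exact_mod_cast Nat.choose_pos (by simpa using card_le_univ B)
  have hle : (n.choose #B : ℝ) ≤ N n := by exact_mod_cast Nat.choose_le_middle _ n
  rw [card_univ, Fintype.card_fin, Nat.cast_one, inv_mul_eq_div, le_div_iff₀ hpos]
  linarith

theorem card_small_le (n M : ℕ) (F : Finset (Q n)) :
    #{B ∈ F | ¬ M ≤ #B} ≤ ∑ j ∈ range M, n.choose j := by
  have h : F.filter (fun B => ¬ M ≤ #B) ⊆ (range M).biUnion fun j => layer n j := by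
    intro B hB
    simp only [mem_filter, not_le] at hB
    simp only [mem_biUnion, mem_range, layer, mem_powersetCard_univ]
    exact ⟨#B, hB.2, rfl⟩
  refine (card_le_card h).trans (card_biUnion_le.trans (le_of_eq ?_))
  simp [layer]

theorem card_le_of_isFree {n : ℕ} {F : Finset (Q n)} (hF : IsFree (Q 2) F) :
    (#F : ℝ) ≤ 2.283261 * N n + ((∑ j ∈ range 20000, n.choose j : ℕ) : ℝ) := by
  have hD : IsDiamondFree (F.filter fun B => 20000 ≤ #B) := by
    intro A hA B hB C hC D hD
    exact isDiamondFree_of_isFree hF A (mem_filter.1 hA).1 B (mem_filter.1 hB).1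
      C (mem_filter.1 hC).1 D (mem_filter.1 hD).1
  have h1 := lubell_le_of_isDiamondFree hD (fun B hB => (mem_filter.1 hB).2) univ
  have h2 := card_le_lubell_mul n (F.filter fun B => 20000 ≤ #B)
  have h3 : (#{B ∈ F | ¬ 20000 ≤ #B} : ℝ) ≤ ((∑ j ∈ range 20000, n.choose j : ℕ) : ℝ) :=
    Nat.cast_le.2 (card_small_le n 20000 F)
  have h4 : (#F : ℝ) = #{B ∈ F | 20000 ≤ #B} + #{B ∈ F | ¬ 20000 ≤ #B} := by
    rw [← Nat.cast_add, card_filter_add_card_filter_not]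
  have h5 := mul_le_mul_of_nonneg_right h1 (Nat.cast_nonneg (α := ℝ) (N n))
  linarith

open Classical in
theorem card_le_ex {P : Type} [PartialOrder P] {n : ℕ} {F : Finset (Q n)} (hF : IsFree P F) :
    #F ≤ ex n P :=
  Finset.le_sup (f := Finset.card) (mem_filter.2 ⟨mem_univ _, hF⟩)

open Classical in
theorem ex_le (n : ℕ) : (ex n (Q 2) : ℝ) ≤
    2.283261 * N n + ((∑ j ∈ range 20000, n.choose j : ℕ) : ℝ) := by
  -- the supremum defining `ex` is taken in `ℕ`, so the bound is rounded down first
  refine (Nat.le_floor_iff (by positivity)).1 (Finset.sup_le fun F hF => ?_)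
  exact Nat.le_floor (card_le_of_isFree (mem_filter.1 hF).2)

/-- The sets of bounded size are polynomially many, while `N n ≥ 2 ^ n / (n + 1)`. -/
theorem sum_choose_isLittleO (M : ℕ) :
    (fun n : ℕ => ((∑ j ∈ range M, n.choose j : ℕ) : ℝ)) =o[atTop] fun n => (N n : ℝ) := by
  have h0 := (isLittleO_pow_const_const_pow_of_one_lt (R := ℝ) (M + 1) one_lt_two).comp_tendsto
    (tendsto_add_atTop_nat 1)
  rw [isLittleO_iff] at h0 ⊢
  intro c hc
  filter_upwards [h0 (show 0 < c / (2 * (M + 1)) by positivity)] with n hn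
  simp only [Function.comp_apply, Nat.cast_add, Nat.cast_one, norm_pow, Real.norm_eq_abs] at hn
  rw [abs_of_nonneg (by positivity), abs_of_pos (by norm_num)] at hn
  rw [Real.norm_of_nonneg (Nat.cast_nonneg _), Real.norm_of_nonneg (Nat.cast_nonneg _)]
  have h1 : ((∑ j ∈ range M, n.choose j : ℕ) : ℝ) ≤ M * ((n : ℝ) + 1) ^ M := by
    have : ∑ j ∈ range M, n.choose j ≤ ∑ j ∈ range M, (n + 1) ^ M := by
      refine sum_le_sum fun j hj => (Nat.choose_le_pow n j).trans ?_
      exact (Nat.pow_le_pow_left (Nat.le_succ n) j).trans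
        (Nat.pow_le_pow_right (Nat.succ_pos n) (mem_range.1 hj).le)
    rw [sum_const, card_range, smul_eq_mul] at this
    exact_mod_cast this
  have h2 : (2 : ℝ) ^ n ≤ (n + 1) * N n := by
    have : 2 ^ n ≤ (n + 1) * N n := by
      rw [← Nat.sum_range_choose n]
      refine (sum_le_sum fun j _ => Nat.choose_le_middle j n).trans (le_of_eq ?_)
      rw [sum_const, card_range, smul_eq_mul, N]
    exact_mod_cast this
  have hM : (0 : ℝ) < M + 1 := by positivity
  have hn1 : (0 : ℝ) < n + 1 := by positivity
  have h3 : ((M : ℝ) + 1) * ((n : ℝ) + 1) ^ (M + 1) ≤ c * 2 ^ n := by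
    have := mul_le_mul_of_nonneg_left hn hM.le
    refine this.trans (le_of_eq ?_)
    field_simp
    ring
  refine le_of_mul_le_mul_left ?_ hn1
  calc ((n : ℝ) + 1) * ((∑ j ∈ range M, n.choose j : ℕ) : ℝ)
      ≤ (n + 1) * (M * ((n : ℝ) + 1) ^ M) := mul_le_mul_of_nonneg_left h1 hn1.le
    _ ≤ ((M : ℝ) + 1) * ((n : ℝ) + 1) ^ (M + 1) := by
      have : 0 ≤ ((n : ℝ) + 1) ^ (M + 1) := by positivity
      rw [pow_succ] at this ⊢
      linarith
    _ ≤ c * 2 ^ n := h3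
    _ ≤ c * ((n + 1) * N n) := mul_le_mul_of_nonneg_left h2 hc.le
    _ = (n + 1) * (c * N n) := by ring

theorem sub_choose_succ_isLittleO :
    (fun n : ℕ => (N n : ℝ) - n.choose (n / 2 + 1)) =o[atTop] fun n => (N n : ℝ) := by
  rw [isLittleO_iff]
  intro c hc
  obtain ⟨m, hm⟩ := exists_nat_gt (2 / c)
  filter_upwards [eventually_ge_atTop m] with n hn
  have hle : (n.choose (n / 2 + 1) : ℝ) ≤ N n := by exact_mod_cast Nat.choose_le_middle _ n
  rw [Real.norm_of_nonneg (sub_nonneg.2 hle), Real.norm_of_nonneg (Nat.cast_nonneg _)]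
  have h1 : N n * (n / 2) ≤ n.choose (n / 2 + 1) * (n / 2 + 1) := by
    rw [Nat.choose_succ_right_eq]
    exact Nat.mul_le_mul_left _ (by omega)
  have h2 : (N n : ℝ) * ((n / 2 : ℕ) : ℝ) ≤ n.choose (n / 2 + 1) * (((n / 2 : ℕ) : ℝ) + 1) := by
    exact_mod_cast h1
  have h3 : (n : ℝ) ≤ 2 * ((n / 2 : ℕ) : ℝ) + 1 := by
    exact_mod_cast (by omega : n ≤ 2 * (n / 2) + 1)
  have hmn : (m : ℝ) ≤ n := by exact_mod_cast hn
  rw [div_lt_iff₀ hc] at hm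
  generalize ((n / 2 : ℕ) : ℝ) = k at *
  generalize (n.choose (n / 2 + 1) : ℝ) = x at *
  have hN0 : (0 : ℝ) ≤ N n := Nat.cast_nonneg _
  generalize (N n : ℝ) = y at *
  have hk : 1 ≤ c * (k + 1) := by nlinarith
  have hk1 : 0 < k + 1 := by
    by_contra! h
    nlinarith
  refine le_of_mul_le_mul_right ?_ hk1
  nlinarith

/-- A copy of `Q 2` contains a chain of three sets, hence meets three different layers. -/
theorem isFree_middle (n : ℕ) : IsFree (Q 2) (layer n (n / 2) ∪ layer n (n / 2 + 1)) := by
  rintro ⟨f, hinj, hmono⟩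
  have hcard : ∀ X, #(f X).1 = n / 2 ∨ #(f X).1 = n / 2 + 1 := by
    intro X
    have := (f X).2
    simpa only [mem_union, layer, mem_powersetCard_univ] using this
  have hlt : ∀ X Y, X < Y → #(f X).1 < #(f Y).1 := by
    intro X Y h
    refine card_lt_card (Finset.ssubset_iff_subset_ne.2 ⟨hmono X Y h.le,
      fun h' => h.ne (hinj (Subtype.ext h'))⟩)
  have h1 := hlt ∅ {0} (by decide)
  have h2 := hlt {0} univ (by decide)
  have := hcard ∅; have := hcard {0}; have := hcard univ
  omega

theorem card_middle (n : ℕ) :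
    #(layer n (n / 2) ∪ layer n (n / 2 + 1)) = N n + n.choose (n / 2 + 1) := by
  rw [card_union_of_disjoint]
  · simp [layer, N]
  · rw [disjoint_left]
    intro B h1 h2
    rw [layer, mem_powersetCard_univ] at h1 h2
    omega

end BooleanLattice

theorem theorem1 :
    ∃ ε₁ ε₂ : ℕ → ℝ,
      ε₁ =o[atTop] (fun n : ℕ => (BooleanLattice.N n : ℝ)) ∧
      ε₂ =o[atTop] (fun n : ℕ => (BooleanLattice.N n : ℝ)) ∧
      (∀ n : ℕ,
        2 * (BooleanLattice.N n : ℝ) - ε₁ n ≤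
            (BooleanLattice.ex n (BooleanLattice.Q 2) : ℝ) ∧
        (BooleanLattice.ex n (BooleanLattice.Q 2) : ℝ) ≤
            2.283261 * (BooleanLattice.N n : ℝ) + ε₂ n) ∧
      (∀ n : ℕ,
        BooleanLattice.IsFree (BooleanLattice.Q 2)
            (BooleanLattice.layer n (n / 2) ∪ BooleanLattice.layer n (n / 2 + 1)) ∧
        2 * (BooleanLattice.N n : ℝ) - ε₁ n ≤
            ((BooleanLattice.layer n (n / 2) ∪ BooleanLattice.layer n (n / 2 + 1)).card : ℝ)) := by
  have hmid : ∀ n : ℕ, 2 * (BooleanLattice.N n : ℝ) -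
      ((BooleanLattice.N n : ℝ) - n.choose (n / 2 + 1)) ≤
      ((BooleanLattice.layer n (n / 2) ∪ BooleanLattice.layer n (n / 2 + 1)).card : ℝ) := by
    intro n
    rw [BooleanLattice.card_middle]
    push_cast
    linarith
  refine ⟨_, _, BooleanLattice.sub_choose_succ_isLittleO,
    BooleanLattice.sum_choose_isLittleO 20000, fun n => ⟨?_, BooleanLattice.ex_le n⟩,
    fun n => ⟨BooleanLattice.isFree_middle n, hmid n⟩⟩
  refine (hmid n).trans (Nat.cast_le.2 ?_)
  exact BooleanLattice.card_le_ex (BooleanLattice.isFree_middle n)
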